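/- For integers $0\le k\le N$ let $U_{k,N}$ be the uniform matroid of rank $k$ on $[N]=\{1,\dots,N\}$. For a matroid $M$ on a finite ground set $E$ let $\mathcal P(M)\subset\mathbb R^E$ be the convex hull of the indicator vectors $e_B$ of the bases $B$ of $M$, and let $i(M,t)$ denote the Ehrhart polynomial of $\mathcal P(M)$, that is, the polynomial in $t$ with $i(M,t)=|t\,\mathcal P(M)\cap\mathbb Z^E|$ for every positive integer $t$. Call $M$ Ehrhart positive if all coefficients of $i(M,t)$, up to its degree, are positive. Let $a,b,n$ be positive integers. The $(a,b)$-Catalan matroid $C_n^{a,b}$ is the matroid on $[n(a+b)]$ whose bases are the sets $T$ with $|T|=|S|$ such that, for each $i$, the $i$-th smallest element of $T$ is at most the $i$-th smallest element of $S$, where $S\subseteq[n(a+b)]$ is the set with indicator vector $(0^a,1^b,0^a,1^b,\dots,0^a,1^b)$ ($n$ repetitions of $0^a,1^b$). For a positive integer $m$ let $U_m^{a,b}=U_{mb,\,m(a+b)}$, and for a partition $\lambda=(\lambda_1,\dots,\lambda_k)\vdash n$ let $U_\lambda^{a,b}=U_{\lambda_1}^{a,b}\oplus\cdots\oplus U_{\lambda_k}^{a,b}$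 and $z_\lambda=\prod_{i=1}^n i^{\alpha_i}\alpha_i!$, where $\alpha_i$ is the number of parts of $\lambda$ equal to $i$. Then the Ehrhart polynomials of $C_n^{a,b}$, of every $U_m^{a,b}$ and of every $U_\lambda^{a,b}$ with $\lambda\vdash n$ exist; for every $\lambda=(\lambda_1,\dots,\lambda_k)\vdash n$, $$i(U_\lambda^{a,b},t)=\prod_{j=1}^k i(U_{\lambda_j}^{a,b},t);$$ and $$i(C_n^{a,b},t)=\sum_{\lambda\vdash n}\frac1{z_\lambda}\,i(U_\lambda^{a,b},t).$$ Moreover, $C_n^{a,b}$ is Ehrhart positive. -/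

import Mathlib

open scoped Pointwise

/-! Uniform matroids and their direct sums -/

/-- The uniform matroid `U_{k,N}` on an `N`-element ground set: a set is independent exactly
when it has at most `k` elements. -/
def uniformMatroid (k N : ℕ) : Matroid (Fin N) :=
  (IndepMatroid.ofFinite (E := Set.univ) Set.finite_univ (fun I => I.ncard ≤ k)
    (by simp)
    (fun I J hJ hIJ => (Set.ncard_le_ncard hIJ).trans hJ)
    (fun I J _ hJ hlt => by
      obtain ⟨e, heJ, heI⟩ := Set.exists_mem_notMem_of_ncard_lt_ncard hlt
      exact ⟨e, heJ, heI, by rw [Set.ncard_insert_of_notMem heI]; omega⟩)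
    (fun _ _ => Set.subset_univ _)).matroid

/-- `U_m^{a,b}`, the uniform matroid of rank `m b` on `m (a + b)` elements. -/
def uniformAB (a b m : ℕ) : Matroid (Fin (m * (a + b))) :=
  uniformMatroid (m * b) (m * (a + b))

/-- `U_lam^{a,b}`, the direct sum of the matroids `U_m^{a,b}` over the parts `m` of the
partition `lam`, taken with multiplicity. -/
def uniformSumAB (a b : ℕ) {n : ℕ} (lam : n.Partition) :
    Matroid ((m : lam.parts) × Fin ((m : ℕ) * (a + b))) :=
  Matroid.sigma fun m : lam.parts => uniformAB a b (m : ℕ)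

/-! Schubert matroids and `(a,b)`-Catalan matroids -/

/-- The componentwise order on subsets: `T` and `S` have the same size, and for each `i` the
`i`-th smallest element of `T` is at most the `i`-th smallest element of `S`. -/
def GaleLE {N : ℕ} (T S : Finset (Fin N)) : Prop :=
  ∃ h : T.card = S.card, ∀ i : Fin S.card, T.orderEmbOfFin h i ≤ S.orderEmbOfFin rfl i

theorem card_filter_orderEmbOfFin {N k : ℕ} (T : Finset (Fin N)) (h : T.card = k) (j : Fin N) :
    (T.filter (· ≤ j)).card =
      ((Finset.univ : Finset (Fin k)).filter (fun i => T.orderEmbOfFin h i ≤ j)).card := by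
  rw [← Finset.card_map (T.orderEmbOfFin h).toEmbedding]
  congr 1
  ext x
  simp only [Finset.mem_filter, Finset.mem_map, Finset.mem_univ, true_and,
    RelEmbedding.coe_toEmbedding]
  constructor
  · rintro ⟨hx, hxj⟩
    have : x ∈ Set.range (T.orderEmbOfFin h) := by
      rw [Finset.range_orderEmbOfFin]; exact hx
    obtain ⟨i, rfl⟩ := this
    exact ⟨i, hxj, rfl⟩
  · rintro ⟨i, hi, rfl⟩
    exact ⟨Finset.orderEmbOfFin_mem T h i, hi⟩

theorem galeLE_iff {N : ℕ} (T S : Finset (Fin N)) :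
    GaleLE T S ↔ T.card = S.card ∧
      ∀ j : Fin N, (S.filter (· ≤ j)).card ≤ (T.filter (· ≤ j)).card := by
  constructor
  · rintro ⟨h, hle⟩
    refine ⟨h, fun j => ?_⟩
    rw [card_filter_orderEmbOfFin S rfl, card_filter_orderEmbOfFin T h]
    refine Finset.card_le_card fun i hi => ?_
    simp only [Finset.mem_filter, Finset.mem_univ, true_and] at hi ⊢
    exact (hle i).trans hi
  · rintro ⟨h, hle⟩
    refine ⟨h, fun i => ?_⟩
    by_contra hlt
    rw [not_le] at hlt
    have hj := hle (S.orderEmbOfFin rfl i)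
    rw [card_filter_orderEmbOfFin S rfl, card_filter_orderEmbOfFin T h] at hj
    have h1 : ((Finset.univ : Finset (Fin S.card)).filter
        (fun i' => S.orderEmbOfFin rfl i' ≤ S.orderEmbOfFin rfl i)) = Finset.Iic i := by
      ext x; simp
    have h2 : ((Finset.univ : Finset (Fin S.card)).filter
        (fun i' => T.orderEmbOfFin h i' ≤ S.orderEmbOfFin rfl i)) ⊆ Finset.Iio i := by
      intro x hx
      simp only [Finset.mem_filter, Finset.mem_univ, true_and] at hx
      have := hx.trans_lt hlt
      simpa using this
    have h3 := Finset.card_le_card h2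
    rw [h1] at hj
    simp only [Fin.card_Iic, Fin.card_Iio] at hj h3
    omega

theorem galeLE_exchange {N : ℕ} {S B C : Finset (Fin N)} (hB : GaleLE B S) (hC : GaleLE C S)
    {e : Fin N} (he : e ∈ B) (heC : e ∉ C) :
    ∃ f ∈ C, f ∉ B ∧ GaleLE (insert f (B.erase e)) S := by
  rw [galeLE_iff] at hB hC
  have hne : (C \ B).Nonempty := by
    rw [Finset.sdiff_nonempty]
    intro hsub
    have := Finset.eq_of_subset_of_card_le hsub (by rw [hB.1, hC.1])
    exact heC (this ▸ he)
  have hmin := Finset.min'_mem _ hne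
  have hmin' := fun x hx => Finset.min'_le (C \ B) x hx
  set f := (C \ B).min' hne
  rw [Finset.mem_sdiff] at hmin
  have hfe : f ∉ B.erase e := fun h => hmin.2 (Finset.mem_of_mem_erase h)
  refine ⟨f, hmin.1, hmin.2, ?_⟩
  rw [galeLE_iff]
  refine ⟨by rw [Finset.card_insert_of_notMem hfe, Finset.card_erase_add_one he, hB.1],
    fun j => ?_⟩
  have key : ((B.erase e).filter (· ≤ j)) = (B.filter (· ≤ j)).erase e := by
    rw [Finset.filter_erase]
  by_cases hfj : f ≤ j
  · rw [Finset.filter_insert, if_pos hfj, Finset.card_insert_of_notMem (by simp [hfe]), key]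
    have := Finset.pred_card_le_card_erase (s := B.filter (· ≤ j)) (a := e)
    have := hB.2 j
    omega
  · rw [Finset.filter_insert, if_neg hfj, key]
    by_cases hej : e ≤ j
    · refine (hC.2 j).trans (Finset.card_le_card fun x hx => ?_)
      rw [Finset.mem_filter] at hx
      have hxB : x ∈ B := by
        by_contra hxB
        exact hfj ((hmin' x (Finset.mem_sdiff.2 ⟨hx.1, hxB⟩)).trans hx.2)
      rw [Finset.mem_erase, Finset.mem_filter]
      exact ⟨fun h => heC (h ▸ hx.1), hxB, hx.2⟩
    · rw [Finset.erase_eq_of_notMem (by simp [hej])]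
      exact hB.2 j

theorem galeLE_exchangeProperty {N : ℕ} (S : Finset (Fin N)) :
    Matroid.ExchangeProperty
      (fun B : Set (Fin N) => ∃ T : Finset (Fin N), (T : Set (Fin N)) = B ∧ GaleLE T S) := by
  rintro _ _ ⟨B, rfl, hB⟩ ⟨C, rfl, hC⟩ e ⟨he, heC⟩
  obtain ⟨f, hfC, hfB, hf⟩ := galeLE_exchange hB hC (by simpa using he) (by simpa using heC)
  exact ⟨f, ⟨by simpa using hfC, by simpa using hfB⟩, _, by simp, hf⟩

/-- The Schubert matroid of `S`: its bases are the sets `T` with `T ≤ S` componentwise. -/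
def schubertMatroid {N : ℕ} (S : Finset (Fin N)) : Matroid (Fin N) :=
  Matroid.ofIsBaseOfFinite (E := Set.univ) Set.finite_univ
    (fun B => ∃ T : Finset (Fin N), (T : Set (Fin N)) = B ∧ GaleLE T S)
    ⟨S, S, rfl, rfl, fun _ => le_rfl⟩
    (galeLE_exchangeProperty S)
    (fun _ _ => Set.subset_univ _)

/-- The `(a,b)`-Catalan matroid `C_n^{a,b}` on `n (a + b)` elements: the Schubert matroid of the
set whose indicator vector is the block of `a` zeros followed by `b` ones, repeated `n` times.
The ground set is `{0, …, n (a + b) - 1}`. -/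
def catalanMatroid (a b n : ℕ) : Matroid (Fin (n * (a + b))) :=
  schubertMatroid (Finset.univ.filter fun i => a ≤ (i : ℕ) % (a + b))

/-! Matroid polytopes and Ehrhart polynomials -/

/-- The matroid polytope: the convex hull of the 0-1 vectors of the bases. -/
def matroidPolytope {α : Type*} (M : Matroid α) : Set (α → ℝ) :=
  convexHull ℝ {v | ∃ B : Set α, M.IsBase B ∧ v = B.indicator 1}

/-- `i(P, t)`, the number of integer points of the dilation `t P`. -/
noncomputable def latticeCount {α : Type*} (P : Set (α → ℝ)) (t : ℕ) : ℕ :=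
  {x : α → ℤ | (fun i => (x i : ℝ)) ∈ (t : ℝ) • P}.ncard

/-- `p` is the Ehrhart polynomial of `P`: it gives the number of integer points of `t P` for
every positive integer `t`. (There is at most one such polynomial.) -/
def IsEhrhartPolynomial {α : Type*} (P : Set (α → ℝ)) (p : Polynomial ℚ) : Prop :=
  ∀ t : ℕ, 0 < t → p.eval (t : ℚ) = latticeCount P t

open Classical in
/-- The Ehrhart polynomial `i(M, t)` of the matroid polytope of `M`. -/
noncomputable def ehrhart {α : Type*} (M : Matroid α) : Polynomial ℚ :=
  if h : ∃ p, IsEhrhartPolynomial (matroidPolytope M) p then h.choose else 0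

/-- `M` is Ehrhart positive: its polytope has an Ehrhart polynomial, and all the coefficients of
that polynomial, up to its degree, are positive. -/
def EhrhartPositive {α : Type*} (M : Matroid α) : Prop :=
  IsEhrhartPolynomial (matroidPolytope M) (ehrhart M) ∧
    ∀ j ≤ (ehrhart M).natDegree, 0 < (ehrhart M).coeff j

/-- `z_lam`, the product over `i = 1, …, n` of `i ^ α_i * α_i !`, where `α_i` is the number of
parts of `lam` equal to `i`. -/
def zPartition {n : ℕ} (lam : n.Partition) : ℕ :=
  ∏ i ∈ Finset.Icc 1 n, i ^ lam.parts.count i * (lam.parts.count i).factorial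

/-! The lattice points of the `t`-th dilation become walks. For a Schubert matroid they are the
vectors with entries in `{0, …, t}`, prescribed total, and prefix sums bounded below. For
`catalanMatroid a b n` only the bounds at the ends of the `n` blocks of length `a + b` matter
(`prefix_le_iff`). Giving a block the height "sum of its entries minus `t b`" turns the lattice
points into excursions of `n` steps. The lattice points for `uniformAB a b m` are in the same way
the bridges of `m` steps.

Let `E n` and `B n` count excursions and bridges. Marking a position in an excursion, cutting at the
last return to zero before the mark and rotating the rest gives Spitzer's recursion `n E n = ∑ E s *
B (n - s)` (`card_excursions_recursion`). Complete symmetric functions satisfy the same recursion in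
the power sums (`partitionSum_recursion`), so `E n = ∑ B_lam / z_lam`. This holds for every `t > 0`,
hence as an identity of polynomials.

For positivity it suffices to treat hypersimplices, since products and positive combinations
preserve it. With `L = ∑ (1 + x + ⋯ + x ^ (r - 1)) z ^ r / r` one has `((1 - x z) / (1 - z)) ^ y =
exp (y (1 - x) L)`. Applied to Katzman's alternating formula, this shows that the coefficient of `t
^ m` is `N` times the coefficient of `x ^ k z ^ N` in the `m`-th Eulerian polynomial times `L ^ (m +
1) / (m + 1)!`, where no signs remain (`coeff_hypersimplexPoly_eq`).

Both the passage from polytopes to inequalities and the product rule for direct sums rest on integer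
decomposition: an admissible integer vector is a sum of `t` bases, obtained by rounding its prefix
sums (`exists_rounding`). -/

/-! Lattice walks: nonnegative bridges, and the Spitzer recursion -/

/-- The total height of a walk whose steps are labelled by `α`, the label `x` having height
`h x`. -/
def walkSum {α : Type*} (h : α → ℤ) (l : List α) : ℤ := (l.map h).sum

@[simp] theorem walkSum_nil {α : Type*} (h : α → ℤ) : walkSum h [] = 0 := rfl

@[simp] theorem walkSum_append {α : Type*} (h : α → ℤ) (u v : List α) :
    walkSum h (u ++ v) = walkSum h u + walkSum h v := by
  simp [walkSum]

/-- A walk which returns to its starting height and never goes below it. -/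
def IsExcursion {α : Type*} (h : α → ℤ) (l : List α) : Prop :=
  walkSum h l = 0 ∧ ∀ u v, l = u ++ v → 0 ≤ walkSum h u

/-- All suffixes of the walk have nonpositive total height. -/
def SuffixNonpos {α : Type*} (h : α → ℤ) (l : List α) : Prop :=
  ∀ u v, l = u ++ v → walkSum h v ≤ 0

/-- All nonempty prefixes of the walk have positive total height. -/
def PrefixPos {α : Type*} (h : α → ℤ) (l : List α) : Prop :=
  ∀ u v, l = u ++ v → u ≠ [] → 0 < walkSum h u

/-- The cut is at the last time the walk attains its minimum: earlier heights are at least that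
value, later ones strictly larger. -/
theorem exists_split {α : Type*} (h : α → ℤ) (l : List α) :
    ∃ u v, l = u ++ v ∧ SuffixNonpos h u ∧ PrefixPos h v := by
  induction l using List.reverseRecOn with
  | nil =>
    refine ⟨[], [], rfl, ?_, ?_⟩
    · intro u v huv
      obtain ⟨rfl, rfl⟩ := List.append_eq_nil_iff.1 huv.symm
      simp
    · intro u v huv hu
      exact absurd (List.append_eq_nil_iff.1 huv.symm).1 hu
  | append_singleton l a ih =>
    obtain ⟨u, v, rfl, hu, hv⟩ := ih
    by_cases hs : 0 < walkSum h (v ++ [a])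
    · refine ⟨u, v ++ [a], by simp, hu, ?_⟩
      intro p q hpq hp
      rcases List.eq_nil_or_concat' q with rfl | ⟨q', b, rfl⟩
      · rw [List.append_nil] at hpq
        exact hpq ▸ hs
      · rw [← List.append_assoc] at hpq
        exact hv p q' (List.append_inj_left' hpq rfl) hp
    -- The new endpoint is no higher than the old minimum, so the cut moves to the end.
    · refine ⟨u ++ (v ++ [a]), [], by simp, ?_, ?_⟩
      · intro p q hpq
        rcases List.append_eq_append_iff.1 hpq with ⟨w, rfl, hw⟩ | ⟨w, hw, rfl⟩
        · have hq : 0 ≤ walkSum h w ∨ q = [] := by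
            rcases List.eq_nil_or_concat' q with rfl | ⟨q', b, rfl⟩
            · exact Or.inr rfl
            · left
              rw [← List.append_assoc] at hw
              rcases eq_or_ne w [] with rfl | hne
              · simp
              · exact (hv w q' (List.append_inj_left' hw rfl) hne).le
          rcases hq with hq | rfl
          · have := congrArg (walkSum h) hw
            rw [walkSum_append h w q] at this
            omega
          · simp
        · have := hu p w hw
          rw [walkSum_append]
          omega
      · intro u v huv hu
        exact absurd (List.append_eq_nil_iff.1 huv.symm).1 hu

/-- A nonempty stretch between two such cuts would be a prefix of positive height and a suffix of
nonpositive height. -/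
theorem split_unique {α : Type*} (h : α → ℤ) {u v u' v' : List α} (he : u ++ v = u' ++ v')
    (hu : SuffixNonpos h u) (hv : PrefixPos h v) (hu' : SuffixNonpos h u')
    (hv' : PrefixPos h v') : u = u' ∧ v = v' := by
  rcases List.append_eq_append_iff.1 he with ⟨w, rfl, rfl⟩ | ⟨w, rfl, rfl⟩
  · rcases eq_or_ne w [] with rfl | hne
    · simp
    · exact absurd (hv w v' rfl hne) (not_lt.2 (hu' u w rfl))
  · rcases eq_or_ne w [] with rfl | hne
    · simp
    · exact absurd (hv' w v rfl hne) (not_lt.2 (hu u' w rfl))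

/-! ### Marked excursions and their double count -/

/-- The walks `u ++ v ++ w`, together with the position at which `w` begins, are the excursions
with a marked position; the pairs `(u, w ++ v)` consist of an excursion and a bridge. -/
structure MarkedWalk {α : Type*} (h : α → ℤ) (n : ℕ) where
  (u v w : List α)
  length_eq : u.length + v.length + w.length = n
  w_ne : w ≠ []
  exc : IsExcursion h u
  pos : PrefixPos h v
  nonpos : SuffixNonpos h w
  sum_eq : walkSum h w + walkSum h v = 0

theorem IsExcursion.suffixNonpos {α : Type*} {h : α → ℤ} {l : List α} (hl : IsExcursion h l) :
    SuffixNonpos h l := by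
  rintro u v rfl
  have h1 := hl.1
  have h2 := hl.2 u v rfl
  rw [walkSum_append] at h1
  omega

/-- The walks of length `n` that are excursions. -/
abbrev Excursions {α : Type*} (h : α → ℤ) (n : ℕ) := {l : List α // l.length = n ∧ IsExcursion h l}

/-- The walks of length `n` that return to their starting height. -/
abbrev Bridges {α : Type*} (h : α → ℤ) (n : ℕ) := {l : List α // l.length = n ∧ walkSum h l = 0}

theorem MarkedWalk.isExcursion {α : Type*} {h : α → ℤ} {n : ℕ} (x : MarkedWalk h n) :
    IsExcursion h (x.u ++ x.v ++ x.w) := by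
  have hs := x.sum_eq
  have hv0 : ∀ p q, x.v = p ++ q → 0 ≤ walkSum h p := fun p q hpq => by
    rcases eq_or_ne p [] with rfl | hne
    · simp
    · exact (x.pos p q hpq hne).le
  refine ⟨by simp only [walkSum_append, x.exc.1]; omega, fun p q hpq => ?_⟩
  rcases List.append_eq_append_iff.1 hpq with ⟨r, rfl, hr⟩ | ⟨r, hr, rfl⟩
  · have := x.nonpos r q hr
    rw [hr] at hs
    simp only [walkSum_append, x.exc.1] at hs ⊢
    omega
  · rcases List.append_eq_append_iff.1 hr with ⟨s, rfl, hs'⟩ | ⟨s, hs', rfl⟩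
    · have := hv0 s r hs'
      rw [walkSum_append, x.exc.1]
      omega
    · exact x.exc.2 p s hs'

/-- Forget the splitting, but not the mark. -/
def MarkedWalk.toExcursion {α : Type*} {h : α → ℤ} {n : ℕ} (x : MarkedWalk h n) :
    Excursions h n × Fin n :=
  (⟨x.u ++ x.v ++ x.w, by simpa [add_assoc] using x.length_eq, x.isExcursion⟩,
    ⟨x.u.length + x.v.length, by
      have := x.length_eq
      have := List.length_pos_iff.2 x.w_ne
      omega⟩)

/-- Cut off the part after the last return before the mark, and rotate it. -/
def MarkedWalk.toPair {α : Type*} {h : α → ℤ} {n : ℕ} (x : MarkedWalk h n) :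
    (s : Fin n) × Excursions h s × Bridges h (n - s) :=
  ⟨⟨x.u.length, by
      have := x.length_eq
      have := List.length_pos_iff.2 x.w_ne
      omega⟩, ⟨x.u, rfl, x.exc⟩, ⟨x.w ++ x.v, by
      have := x.length_eq
      simp only [List.length_append]
      omega, by simpa using x.sum_eq⟩⟩

/-- The part before the mark is split at its last minimum. In an excursion that minimum is `0`, so
`u` ends at the last return to zero before the mark. -/
theorem MarkedWalk.toExcursion_bijective {α : Type*} (h : α → ℤ) (n : ℕ) :
    Function.Bijective (MarkedWalk.toExcursion : MarkedWalk h n → _) := by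
  constructor
  · rintro ⟨u, v, w, hl, hw, hu, hv, hw', hs⟩ ⟨u₁, v₁, w₁, hl₁, hw₁, hu₁, hv₁, hw₁', hs₁⟩ he
    simp only [toExcursion, Prod.mk.injEq, Subtype.mk.injEq, Fin.mk.injEq] at he
    obtain ⟨h1, h2⟩ := List.append_inj he.1 (by simpa using he.2)
    obtain ⟨h3, h4⟩ := split_unique h h1 hu.suffixNonpos hv hu₁.suffixNonpos hv₁
    subst h2 h3 h4
    rfl
  · rintro ⟨⟨c, hc, hexc⟩, i, hi⟩
    obtain ⟨u, v, huv, hu, hv⟩ := exists_split h (c.take i)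
    have hcuv : c = u ++ v ++ c.drop i := by rw [← huv, List.take_append_drop]
    have hlen : u.length + v.length = i := by
      rw [← List.length_append, ← huv, List.length_take]; omega
    have hu0 : walkSum h u = 0 := by
      have h1 := hu [] u rfl
      have h2 := hexc.2 u (v ++ c.drop i) (by rw [← List.append_assoc]; exact hcuv)
      omega
    refine ⟨⟨u, v, c.drop i, ?_, ?_, ⟨hu0, fun p q hpq => ?_⟩, hv, fun p q hpq => ?_, ?_⟩, ?_⟩
    · rw [List.length_drop]; omega
    · rw [← List.length_pos_iff, List.length_drop]; omega
    · refine hexc.2 p (q ++ v ++ c.drop i) (hcuv.trans ?_)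
      rw [hpq]; simp
    · refine hexc.suffixNonpos (u ++ v ++ p) q (hcuv.trans ?_)
      rw [hpq]; simp
    · have := hexc.1
      rw [hcuv] at this
      simp only [walkSum_append] at this
      omega
    · simp only [toExcursion, Prod.mk.injEq, Subtype.mk.injEq, Fin.mk.injEq]
      exact ⟨hcuv.symm, hlen⟩

/-- After rotation, `w ++ v` is the splitting of a bridge at its last minimum, so existence and
uniqueness of that splitting give the inverse. -/
theorem MarkedWalk.toPair_bijective {α : Type*} (h : α → ℤ) (n : ℕ) :
    Function.Bijective (MarkedWalk.toPair : MarkedWalk h n → _) := by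
  constructor
  · rintro ⟨u, v, w, hl, hw, hu, hv, hw', hs⟩ ⟨u₁, v₁, w₁, hl₁, hw₁, hu₁, hv₁, hw₁', hs₁⟩ he
    have h1 : u = u₁ := congrArg (fun x => (x.2.1 : List α)) he
    have h2 : w ++ v = w₁ ++ v₁ := congrArg (fun x => (x.2.2 : List α)) he
    obtain ⟨h3, h4⟩ := split_unique h h2 hw' hv hw₁' hv₁
    subst h1 h3 h4
    rfl
  · rintro ⟨⟨s, hs⟩, ⟨u, hul, hu⟩, ⟨b, hbl, hb⟩⟩
    obtain ⟨w, v, rfl, hw, hv⟩ := exists_split h b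
    simp only at hul hbl
    subst hul
    rw [walkSum_append] at hb
    rw [List.length_append] at hbl
    -- If `w` were empty, the nonempty bridge would consist of `v` alone and have positive height.
    have hwne : w ≠ [] := by
      rintro rfl
      have hvne : v ≠ [] := by
        rw [← List.length_pos_iff]
        simp only [List.length_nil] at hbl
        omega
      have := hv v [] (by simp) hvne
      simp at hb
      omega
    exact ⟨⟨u, v, w, by omega, hwne, hu, hv, hw, hb⟩, rfl⟩

theorem finite_walks {α : Type*} [Finite α] (n : ℕ) (P : List α → Prop) :
    Finite {l : List α // l.length = n ∧ P l} :=
  Set.Finite.to_subtype ((List.finite_length_eq α n).subset fun _ hl => hl.1)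

theorem card_excursions_recursion {α : Type*} [Finite α] (h : α → ℤ) (n : ℕ) :
    n * Nat.card (Excursions h n) =
      ∑ s ∈ Finset.range n, Nat.card (Excursions h s) * Nat.card (Bridges h (n - s)) := by
  have h1 := Nat.card_congr ((Equiv.ofBijective _ (MarkedWalk.toExcursion_bijective h n)).symm.trans
    (Equiv.ofBijective _ (MarkedWalk.toPair_bijective h n)))
  have (m : ℕ) : Finite (Excursions h m) := finite_walks m _
  have (m : ℕ) : Finite (Bridges h m) := finite_walks m _
  rw [Nat.card_prod, Nat.card_sigma, Nat.card_fin, mul_comm] at h1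
  rw [h1, Finset.sum_range]
  simp_rw [Nat.card_prod]

theorem card_excursions_zero {α : Type*} (h : α → ℤ) : Nat.card (Excursions h 0) = 1 := by
  rw [Nat.card_eq_one_iff_exists]
  refine ⟨⟨[], rfl, by simp, fun u v huv => ?_⟩, fun l => Subtype.ext
    (List.length_eq_zero_iff.1 l.2.1)⟩
  rw [(List.append_eq_nil_iff.1 huv.symm).1]
  simp

/-! The exponential formula, as a sum over partitions -/

/-- The complete symmetric function expanded in power sums: the sum over the partitions `lam`
of `n` of `∏ p (lam_j) / z_lam`. -/
noncomputable def partitionSum (p : ℕ → ℚ) (n : ℕ) : ℚ :=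
  ∑ lam : n.Partition, (1 / (zPartition lam : ℚ)) * (lam.parts.map p).prod

theorem Nat.Partition.mem_Icc {n : ℕ} (lam : n.Partition) {i : ℕ} (hi : i ∈ lam.parts) :
    i ∈ Finset.Icc 1 n := by
  rw [Finset.mem_Icc]
  exact ⟨lam.parts_pos hi, lam.parts_sum ▸ Multiset.le_sum_of_mem hi⟩

theorem zPartition_eq {n N : ℕ} (hN : n ≤ N) (lam : n.Partition) :
    zPartition lam =
      ∏ i ∈ Finset.Icc 1 N, i ^ lam.parts.count i * (lam.parts.count i).factorial := by
  refine Finset.prod_subset (Finset.Icc_subset_Icc le_rfl hN) fun i _ hi => ?_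
  rw [Multiset.count_eq_zero.2 fun h => hi (lam.mem_Icc h)]
  simp

theorem Nat.Partition.sum_mul_count {n : ℕ} (lam : n.Partition) :
    ∑ i ∈ Finset.Icc 1 n, i * lam.parts.count i = n := by
  conv_rhs => rw [← lam.parts_sum, Finset.sum_multiset_count]
  symm
  simp_rw [smul_eq_mul, mul_comm]
  refine Finset.sum_subset (fun i hi => lam.mem_Icc (Multiset.mem_toFinset.1 hi)) fun i _ hi => ?_
  rw [Multiset.count_eq_zero.2 fun h => hi (Multiset.mem_toFinset.2 h), mul_zero]

/-- Add a part to a partition. -/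
def Nat.Partition.consPart {n i : ℕ} (hi : i ∈ Finset.Icc 1 n) (mu : (n - i).Partition) :
    n.Partition where
  parts := i ::ₘ mu.parts
  parts_pos := by
    rw [Finset.mem_Icc] at hi
    intro j hj
    rcases Multiset.mem_cons.1 hj with rfl | hj
    · exact hi.1
    · exact mu.parts_pos hj
  parts_sum := by
    rw [Finset.mem_Icc] at hi
    rw [Multiset.sum_cons, mu.parts_sum]
    omega

/-- Remove a part from a partition. -/
def Nat.Partition.erasePart {n : ℕ} (lam : n.Partition) (i : ℕ) (hi : i ∈ lam.parts) :
    (n - i).Partition where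
  parts := lam.parts.erase i
  parts_pos := fun hj => lam.parts_pos (Multiset.mem_of_mem_erase hj)
  parts_sum := by
    have := Multiset.sum_erase hi
    rw [lam.parts_sum] at this
    omega

theorem zPartition_consPart {n i : ℕ} (hi : i ∈ Finset.Icc 1 n) (mu : (n - i).Partition) :
    zPartition (mu.consPart hi) = i * (mu.consPart hi).parts.count i * zPartition mu := by
  have hparts : (mu.consPart hi).parts = i ::ₘ mu.parts := rfl
  rw [zPartition_eq le_rfl, zPartition_eq (Nat.sub_le n i) mu, hparts,
    ← Finset.mul_prod_erase _ _ hi, ← Finset.mul_prod_erase _ _ hi, ← mul_assoc,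
    Multiset.count_cons_self]
  congr 1
  · rw [pow_succ, Nat.factorial_succ]
    ring
  · refine Finset.prod_congr rfl fun j hj => ?_
    rw [Multiset.count_cons_of_ne (Finset.ne_of_mem_erase hj)]

theorem zPartition_ne_zero {n : ℕ} (lam : n.Partition) : zPartition lam ≠ 0 := by
  refine Finset.prod_ne_zero_iff.2 fun i hi => ?_
  rw [Finset.mem_Icc] at hi
  exact mul_ne_zero (pow_ne_zero _ (by omega)) (Nat.factorial_ne_zero _)

/-- Removing one part `i` is a bijection from the partitions containing `i` to the partitions of `n
- i`; it divides `z` by exactly `i * count i`, which the weight compensates. -/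
theorem sum_count_partition (p : ℕ → ℚ) {n i : ℕ} (hi : i ∈ Finset.Icc 1 n) :
    ∑ lam : n.Partition, ((i * lam.parts.count i : ℕ) : ℚ) *
      ((1 / (zPartition lam : ℚ)) * (lam.parts.map p).prod) = p i * partitionSum p (n - i) := by
  rw [partitionSum, Finset.mul_sum, ← Finset.sum_filter_of_ne (p := fun lam => i ∈ lam.parts)]
  · symm
    refine Finset.sum_bij' (fun mu _ => mu.consPart hi)
      (fun lam hlam => lam.erasePart i (Finset.mem_filter.1 hlam).2) ?_ ?_ ?_ ?_ ?_
    · intro mu _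
      simp [Nat.Partition.consPart]
    · simp
    · intro mu _
      ext1
      simp [Nat.Partition.consPart, Nat.Partition.erasePart]
    · intro lam hlam
      ext1
      simpa [Nat.Partition.consPart, Nat.Partition.erasePart] using
        Multiset.cons_erase (Finset.mem_filter.1 hlam).2
    · intro mu _
      have hz := zPartition_consPart hi mu
      have h0 := zPartition_ne_zero (mu.consPart hi)
      rw [hz] at h0 ⊢
      have hparts : ((mu.consPart hi).parts.map p).prod = p i * (mu.parts.map p).prod := by
        simp [Nat.Partition.consPart]
      rw [hparts]
      have h1 : ((i * (mu.consPart hi).parts.count i : ℕ) : ℚ) ≠ 0 :=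
        Nat.cast_ne_zero.2 (left_ne_zero_of_mul h0)
      have h2 : (zPartition mu : ℚ) ≠ 0 := Nat.cast_ne_zero.2 (zPartition_ne_zero mu)
      rw [Nat.cast_mul (i * _)]
      field_simp
  · intro lam _ hne
    by_contra hmem
    rw [Multiset.count_eq_zero.2 hmem] at hne
    simp at hne

/-- Newton's identity for complete symmetric functions: write the factor `n` as `∑ i * count i`
inside each term and remove a part `i`. -/
theorem partitionSum_recursion (p : ℕ → ℚ) (n : ℕ) :
    n * partitionSum p n = ∑ s ∈ Finset.range n, partitionSum p s * p (n - s) := by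
  have h1 : (n : ℚ) * partitionSum p n =
      ∑ i ∈ Finset.Icc 1 n, p i * partitionSum p (n - i) := by
    rw [← Finset.sum_congr rfl fun i hi => sum_count_partition p hi, Finset.sum_comm,
      partitionSum, Finset.mul_sum]
    refine Finset.sum_congr rfl fun lam _ => ?_
    rw [← Finset.sum_mul]
    congr 1
    exact_mod_cast lam.sum_mul_count.symm
  rw [h1]
  refine Finset.sum_bij' (fun i _ => n - i) (fun s _ => n - s) ?_ ?_ ?_ ?_ ?_
  · intro i hi
    simp only [Finset.mem_Icc, Finset.mem_range] at *
    omega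
  · intro i hi
    simp only [Finset.mem_Icc, Finset.mem_range] at *
    omega
  · intro i hi
    simp only [Finset.mem_Icc] at *
    omega
  · intro i hi
    simp only [Finset.mem_range] at *
    omega
  · intro i hi
    rw [Finset.mem_Icc] at hi
    rw [show n - (n - i) = i by omega, mul_comm]

theorem eq_partitionSum {c p : ℕ → ℚ} (h0 : c 0 = 1)
    (hc : ∀ n : ℕ, n * c n = ∑ s ∈ Finset.range n, c s * p (n - s)) (n : ℕ) :
    c n = partitionSum p n := by
  induction n using Nat.strong_induction_on with
  | _ n ih =>
    rcases Nat.eq_zero_or_pos n with rfl | hn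
    · rw [h0, partitionSum, Fintype.sum_unique]
      simp [zPartition]
    · have hn' : (n : ℚ) ≠ 0 := by positivity
      refine mul_left_cancel₀ hn' ?_
      rw [hc, partitionSum_recursion]
      exact Finset.sum_congr rfl fun s hs => by rw [ih s (Finset.mem_range.1 hs)]

/-! Eulerian numbers -/

/-- The Eulerian numbers, with the generating function
`∑ r ^ m x ^ r = (∑ eulerianNum m k x ^ k) / (1 - x) ^ (m + 1)`. -/
def eulerianNum : ℕ → ℕ → ℕ
  | 0, 0 => 1
  | 0, _ + 1 => 0
  | _ + 1, 0 => 0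
  | m + 1, k + 1 => (k + 1) * eulerianNum m (k + 1) + (m + 1 - k) * eulerianNum m k

theorem eulerianNum_eq_zero {m k : ℕ} (h : m < k) : eulerianNum m k = 0 := by
  induction m generalizing k with
  | zero =>
    obtain ⟨k, rfl⟩ := Nat.exists_eq_succ_of_ne_zero h.ne'
    rfl
  | succ m ih =>
    obtain ⟨k, rfl⟩ := Nat.exists_eq_succ_of_ne_zero (Nat.ne_zero_of_lt h)
    rw [Nat.succ_eq_add_one, eulerianNum, ih (by omega), ih (by omega), mul_zero, mul_zero, add_zero]

theorem eulerianNum_pos {m k : ℕ} (hk : 1 ≤ k) (h : k ≤ m) : 0 < eulerianNum m k := by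
  induction m generalizing k with
  | zero => omega
  | succ m ih =>
    obtain ⟨k, rfl⟩ := Nat.exists_eq_add_of_le' hk
    rw [eulerianNum]
    rcases Nat.lt_or_ge k m with hkm | hkm
    · exact Nat.add_pos_left (Nat.mul_pos (by omega) (ih hk hkm)) _
    · obtain rfl : k = m := by omega
      refine Nat.add_pos_right _ (Nat.mul_pos (by omega) ?_)
      rcases Nat.eq_zero_or_pos k with rfl | hk0
      · decide
      · exact ih hk0 le_rfl

/-- The operator `x d/dx` raises the exponent of `r`. Differentiating the identity for `m` turns the
numerator `g` into `x (1 - x) g' + (m + 1) x g`, which is the Eulerian recursion. -/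
theorem mk_pow_mul_one_sub_X_pow (m : ℕ) :
    PowerSeries.mk (fun r => (r : ℚ) ^ m) * (1 - PowerSeries.X) ^ (m + 1) =
      PowerSeries.mk fun k => (eulerianNum m k : ℚ) := by
  induction m with
  | zero =>
    have h1 : PowerSeries.mk (fun r => (r : ℚ) ^ 0) = PowerSeries.mk 1 := by
      ext r; simp
    rw [zero_add, pow_one, h1, PowerSeries.mk_one_mul_one_sub_eq_one]
    ext k
    rcases k with _ | k
    · simp [eulerianNum]
    · simp [eulerianNum, PowerSeries.coeff_one]
  | succ m ih =>
    set f := PowerSeries.mk fun r => (r : ℚ) ^ m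
    set g := PowerSeries.mk fun k => (eulerianNum m k : ℚ) with hg
    have hf : PowerSeries.mk (fun r => (r : ℚ) ^ (m + 1)) =
        PowerSeries.X * PowerSeries.derivative ℚ f := by
      ext r
      rcases r with _ | r
      · simp
      · rw [PowerSeries.coeff_succ_X_mul, PowerSeries.coeff_derivative]
        simp [f, pow_succ]
    have hder := congrArg (PowerSeries.derivative ℚ) ih
    rw [Derivation.leibniz, PowerSeries.derivative_pow] at hder
    simp only [smul_eq_mul, map_sub, PowerSeries.derivative_one, PowerSeries.derivative_X] at hder
    have hrec : PowerSeries.mk (fun r => (r : ℚ) ^ (m + 1)) * (1 - PowerSeries.X) ^ (m + 1 + 1) =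
        PowerSeries.X * PowerSeries.derivative ℚ g
          - PowerSeries.X * (PowerSeries.X * PowerSeries.derivative ℚ g)
          + PowerSeries.X * (((m + 1 : ℕ) : PowerSeries ℚ) * g) := by
      rw [hf, ← hder, ← ih]
      simp only [Nat.add_sub_cancel]
      ring
    rw [hrec]
    ext k
    rcases k with _ | k
    · simp [eulerianNum]
    · have hX : PowerSeries.coeff k (PowerSeries.X * PowerSeries.derivative ℚ g) =
          (k : ℚ) * eulerianNum m k := by
        rcases k with _ | k
        · simp
        · rw [PowerSeries.coeff_succ_X_mul, PowerSeries.coeff_derivative, hg,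
            PowerSeries.coeff_mk]
          push_cast
          ring
      rw [map_add, map_sub, PowerSeries.coeff_succ_X_mul, PowerSeries.coeff_succ_X_mul,
        PowerSeries.coeff_succ_X_mul, hX, PowerSeries.coeff_derivative,
        ← nsmul_eq_mul (m + 1) g, map_nsmul,
        hg, PowerSeries.coeff_mk, PowerSeries.coeff_mk, PowerSeries.coeff_mk, eulerianNum]
      -- The subtraction `m + 1 - k` can truncate only where the Eulerian number it multiplies
      -- vanishes.
      rcases Nat.lt_or_ge m k with hk | hk
      · rw [eulerianNum_eq_zero hk]
        push_cast
        simp [mul_comm]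
      · push_cast [show k ≤ m + 1 by omega]
        simp only [nsmul_eq_mul]
        push_cast
        ring

/-! The power series `((1 - x z) / (1 - z)) ^ y` in `z` -/

/-- The coefficients of `((1 - x z) / (1 - z)) ^ y`, as the product of two binomial series. -/
noncomputable def quotientPow {R : Type*} [CommRing R] [Algebra ℚ R] (x y : R) : PowerSeries R :=
  PowerSeries.mk (fun n => (1 / (n.factorial : ℚ)) • ((-x) ^ n * ∏ i ∈ Finset.range n, (y - i))) *
    PowerSeries.mk (fun n => (1 / (n.factorial : ℚ)) • ∏ i ∈ Finset.range n, (y + i))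

theorem coeff_mk_X_mul_derivative {R : Type*} [CommRing R] (f : PowerSeries R) (n : ℕ) :
    PowerSeries.coeff n (PowerSeries.X * PowerSeries.derivative R f) =
      n * PowerSeries.coeff n f := by
  rcases n with _ | n
  · simp
  · rw [PowerSeries.coeff_succ_X_mul, PowerSeries.coeff_derivative]
    push_cast
    ring

theorem succ_mul_smul_factorial {R : Type*} [CommRing R] [Algebra ℚ R] (n : ℕ) (a : R) :
    ((1 / ((n + 1).factorial : ℚ)) • a) * (n + 1) = (1 / (n.factorial : ℚ)) • a := by
  have h1 : ((n + 1 : ℕ) : R) = algebraMap ℚ R ((n + 1 : ℕ) : ℚ) := by simp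
  have h2 : ((n : R) + 1) = algebraMap ℚ R ((n + 1 : ℕ) : ℚ) := by simp
  rw [h2, mul_comm, ← Algebra.smul_def, smul_smul, Nat.factorial_succ]
  congr 1
  have := Nat.factorial_ne_zero n
  push_cast
  field_simp

/-- The two binomial series satisfy `(1 - z) A' = y A` and `(1 - x z) B' = -x y B`; the product rule
combines them. -/
theorem derivative_quotientPow_aux {R : Type*} [CommRing R] [Algebra ℚ R] (x y : R) :
    PowerSeries.derivative R (quotientPow x y) *
      ((1 - PowerSeries.X) * (1 - PowerSeries.C x * PowerSeries.X)) =
      PowerSeries.C (y * (1 - x)) * quotientPow x y := by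
  rw [quotientPow]
  set B := PowerSeries.mk
    (fun n => (1 / (n.factorial : ℚ)) • ((-x) ^ n * ∏ i ∈ Finset.range n, (y - i))) with hB
  set A := PowerSeries.mk (fun n => (1 / (n.factorial : ℚ)) • ∏ i ∈ Finset.range n, (y + i)) with hA
  have hA' : PowerSeries.derivative R A =
      PowerSeries.X * PowerSeries.derivative R A + PowerSeries.C y * A := by
    ext n
    rw [map_add, coeff_mk_X_mul_derivative, PowerSeries.coeff_derivative, PowerSeries.coeff_C_mul,
      hA, PowerSeries.coeff_mk, PowerSeries.coeff_mk, succ_mul_smul_factorial,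
      Finset.prod_range_succ, mul_smul_comm, mul_smul_comm, ← smul_add]
    congr 1
    ring
  have hB' : PowerSeries.derivative R B =
      PowerSeries.C x * (PowerSeries.X * PowerSeries.derivative R B)
        - PowerSeries.C (x * y) * B := by
    ext n
    rw [map_sub, PowerSeries.coeff_C_mul, coeff_mk_X_mul_derivative, PowerSeries.coeff_derivative,
      PowerSeries.coeff_C_mul, hB, PowerSeries.coeff_mk, PowerSeries.coeff_mk,
      succ_mul_smul_factorial, Finset.prod_range_succ, mul_smul_comm, mul_smul_comm,
      mul_smul_comm, ← smul_sub]
    congr 1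
    ring
  rw [Derivation.leibniz, smul_eq_mul, smul_eq_mul]
  simp only [map_mul, map_sub, map_one] at hB' ⊢
  linear_combination (B * (1 - PowerSeries.C x * PowerSeries.X)) * hA' +
    (A * (1 - PowerSeries.X)) * hB'

theorem derivative_quotientPow {R : Type*} [CommRing R] [IsDomain R] [Algebra ℚ R] (x y : R) :
    PowerSeries.derivative R (quotientPow x y) =
      PowerSeries.C y * (PowerSeries.mk (fun r => 1 - x ^ (r + 1)) * quotientPow x y) := by
  have hne : (1 - PowerSeries.X) * (1 - PowerSeries.C x * PowerSeries.X) ≠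
      (0 : PowerSeries R) := by
    intro h
    have := congrArg PowerSeries.constantCoeff h
    simp at this
  refine mul_right_cancel₀ hne ?_
  have hH : PowerSeries.mk (fun r => 1 - x ^ (r + 1)) *
      ((1 - PowerSeries.X) * (1 - PowerSeries.C x * PowerSeries.X)) =
      (PowerSeries.C (1 - x) : PowerSeries R) := by
    have h1 : PowerSeries.mk (fun r => 1 - x ^ (r + 1)) * (1 - PowerSeries.X) =
        PowerSeries.C (1 - x) * PowerSeries.mk (fun r => x ^ r) := by
      ext n
      rw [mul_sub, mul_one, map_sub, PowerSeries.coeff_C_mul]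
      rcases n with _ | n
      · simp
      · rw [PowerSeries.coeff_succ_mul_X]
        simp only [PowerSeries.coeff_mk]
        ring
    have h2 : PowerSeries.mk (fun r => x ^ r) * (1 - PowerSeries.C x * PowerSeries.X) = 1 := by
      ext n
      rw [mul_sub, mul_one, map_sub, mul_left_comm, PowerSeries.coeff_C_mul]
      rcases n with _ | n
      · simp
      · rw [PowerSeries.coeff_succ_mul_X]
        simp [PowerSeries.coeff_one, pow_succ']
    rw [← mul_assoc, h1, mul_assoc, h2, mul_one]
  rw [derivative_quotientPow_aux, map_mul]
  linear_combination (-(PowerSeries.C y * quotientPow x y)) * hH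

theorem coeff_zero_quotientPow {R : Type*} [CommRing R] [Algebra ℚ R] (x y : R) :
    PowerSeries.coeff 0 (quotientPow x y) = 1 := by
  simp [quotientPow]

/-- Each step of this recursion contributes one factor `y` and one factor `1 - x ^ (r + 1)`, which
allows sorting by powers of `y`. -/
theorem coeff_succ_quotientPow {R : Type*} [CommRing R] [IsDomain R] [Algebra ℚ R] (x y : R)
    (n : ℕ) :
    PowerSeries.coeff (n + 1) (quotientPow x y) = (1 / ((n + 1 : ℕ) : ℚ)) •
      (y * ∑ p ∈ Finset.HasAntidiagonal.antidiagonal n,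
        (1 - x ^ (p.1 + 1)) * PowerSeries.coeff p.2 (quotientPow x y)) := by
  have h := congrArg (PowerSeries.coeff n) (derivative_quotientPow x y)
  rw [PowerSeries.coeff_derivative, PowerSeries.coeff_C_mul, PowerSeries.coeff_mul] at h
  simp only [PowerSeries.coeff_mk] at h
  rw [← h]
  have h2 : ((n : R) + 1) = algebraMap ℚ R ((n + 1 : ℕ) : ℚ) := by simp
  rw [h2, mul_comm, ← Algebra.smul_def, smul_smul]
  have : ((n + 1 : ℕ) : ℚ) ≠ 0 := by positivity
  rw [one_div_mul_cancel this, one_smul]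

/-- The series `L ^ m / m!`, as series in `z` with coefficients in `ℚ⟦x⟧`, where
`L = ∑ (1 + x + ⋯ + x ^ (r - 1)) z ^ r / r`. -/
noncomputable def blockSeries : ℕ → ℕ → PowerSeries ℚ
  | 0, 0 => 1
  | 0, _ + 1 => 0
  | _ + 1, 0 => 0
  | m + 1, n + 1 => (1 / ((n + 1 : ℕ) : ℚ)) • ∑ p ∈ Finset.HasAntidiagonal.antidiagonal n,
      (∑ i ∈ Finset.range (p.1 + 1), PowerSeries.X ^ i) * blockSeries m p.2

/-- Both sides obey one recursion: every factor `y` comes with `1 - x ^ (r + 1) = (1 - x) (1 + ⋯ + x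
^ r)`, and the geometric sums assemble into `blockSeries`. -/
theorem coeff_coeff_quotientPow (m n : ℕ) :
    (PowerSeries.coeff n (quotientPow (R := Polynomial (PowerSeries ℚ))
      (Polynomial.C PowerSeries.X) Polynomial.X)).coeff m =
      (1 - PowerSeries.X) ^ m * blockSeries m n := by
  induction m generalizing n with
  | zero =>
    rcases n with _ | n
    · rw [coeff_zero_quotientPow]
      simp [blockSeries]
    · rw [coeff_succ_quotientPow, Polynomial.coeff_smul, Polynomial.coeff_X_mul_zero]
      simp [blockSeries]
  | succ m ih =>
    rcases n with _ | n
    · rw [coeff_zero_quotientPow]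
      simp [blockSeries, Polynomial.coeff_one]
    · rw [coeff_succ_quotientPow, Polynomial.coeff_smul, Polynomial.coeff_X_mul,
        Polynomial.finsetSum_coeff, blockSeries, mul_smul_comm, Finset.mul_sum]
      congr 1
      refine Finset.sum_congr rfl fun p _ => ?_
      have h1 : (1 - Polynomial.C PowerSeries.X ^ (p.1 + 1) : Polynomial (PowerSeries ℚ)) =
          Polynomial.C (1 - PowerSeries.X ^ (p.1 + 1)) := by simp
      rw [h1, Polynomial.coeff_C_mul, ih, ← mul_neg_geom_sum]
      ring

theorem coeff_blockSeries_nonneg (m n l : ℕ) : 0 ≤ PowerSeries.coeff l (blockSeries m n) := by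
  induction m generalizing n l with
  | zero =>
    rcases n with _ | n
    · rw [blockSeries, PowerSeries.coeff_one]
      split_ifs <;> norm_num
    · simp [blockSeries]
  | succ m ih =>
    rcases n with _ | n
    · simp [blockSeries]
    · rw [blockSeries, PowerSeries.coeff_smul, map_sum]
      refine mul_nonneg (by positivity) (Finset.sum_nonneg fun p _ => ?_)
      rw [PowerSeries.coeff_mul]
      refine Finset.sum_nonneg fun q _ => mul_nonneg ?_ (ih _ _)
      rw [map_sum]
      refine Finset.sum_nonneg fun i _ => ?_
      rw [PowerSeries.coeff_X_pow]
      split_ifs <;> norm_num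

/-- A single term suffices: one block contributes `1 + ⋯ + x ^ (n - m)`, which contains `x ^ l`, and
the other `m` blocks have length one. `h0` is assumed because it is proved by induction from the
case `l = 0`, `n = m`. -/
theorem coeff_blockSeries_pos {m n l : ℕ} (h : l + m ≤ n)
    (h0 : 0 < PowerSeries.coeff 0 (blockSeries m m)) :
    0 < PowerSeries.coeff l (blockSeries (m + 1) (n + 1)) := by
  have hgeom (r q : ℕ) : PowerSeries.coeff q (∑ i ∈ Finset.range (r + 1),
      (PowerSeries.X : PowerSeries ℚ) ^ i) = if q ≤ r then 1 else 0 := by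
    simp [PowerSeries.coeff_X_pow]
  have hnn (p q : ℕ × ℕ) : 0 ≤ PowerSeries.coeff q.1 (∑ i ∈ Finset.range (p.1 + 1),
      (PowerSeries.X : PowerSeries ℚ) ^ i) * PowerSeries.coeff q.2 (blockSeries m p.2) := by
    rw [hgeom]
    have := coeff_blockSeries_nonneg m p.2 q.2
    split_ifs <;> simp [this]
  rw [blockSeries, PowerSeries.coeff_smul, map_sum]
  refine mul_pos (by positivity) (Finset.sum_pos' (fun p _ => ?_) ⟨(n - m, m), ?_, ?_⟩)
  · rw [PowerSeries.coeff_mul]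
    exact Finset.sum_nonneg fun q _ => hnn p q
  · rw [Finset.HasAntidiagonal.mem_antidiagonal]; omega
  · rw [PowerSeries.coeff_mul]
    refine Finset.sum_pos' (fun q _ => hnn _ q) ⟨(l, 0), by simp, ?_⟩
    rw [hgeom, if_pos (by simp only; omega)]
    simpa using h0

theorem coeff_zero_blockSeries_pos (m : ℕ) : 0 < PowerSeries.coeff 0 (blockSeries m m) := by
  induction m with
  | zero => simp [blockSeries]
  | succ m ih => exact coeff_blockSeries_pos (by omega) ih

/-! The Ehrhart polynomials of the hypersimplices -/

/-- `(y + 1 - j) (y + 2 - j) ⋯ (y + N - 1 - j)`. -/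
noncomputable def shiftedProd {R : Type*} [CommRing R] (N j : ℕ) (y : R) : R :=
  ∏ i ∈ Finset.range (N - 1), (y + (i + 1) - j)

/-- The factors run from `y - (j - 1)` to `y + (l - 1)`, with `y` doubled when both products are
nonempty; one copy of `y` is pulled out. -/
theorem prod_sub_mul_prod_add {R : Type*} [CommRing R] (j l : ℕ) (h : 0 < j + l) (y : R) :
    (∏ i ∈ Finset.range j, (y - i)) * ∏ i ∈ Finset.range l, (y + i) =
      y * shiftedProd (j + l) j y := by
  rcases l with _ | l
  · obtain ⟨j, rfl⟩ := Nat.exists_eq_succ_of_ne_zero (show j ≠ 0 by omega)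
    rw [shiftedProd, Finset.prod_range_succ', ← Finset.prod_range_reflect]
    simp only [Finset.range_zero, Finset.prod_empty, mul_one, Nat.cast_zero, sub_zero, add_zero,
      Nat.succ_eq_add_one, Nat.add_sub_cancel]
    rw [mul_comm]
    congr 1
    refine Finset.prod_congr rfl fun i hi => ?_
    rw [Finset.mem_range] at hi
    rw [show j - 1 - i + 1 = j - i by omega, Nat.cast_sub hi.le]
    push_cast
    ring
  · rw [shiftedProd, show j + (l + 1) - 1 = j + l by omega, Finset.prod_range_succ' _ l,
      Finset.prod_range_add, ← Finset.prod_range_reflect (fun i => y - (i : R))]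
    have h1 : ∏ i ∈ Finset.range j, (y - ((j - 1 - i : ℕ) : R)) =
        ∏ i ∈ Finset.range j, (y + (i + 1) - j) := by
      refine Finset.prod_congr rfl fun i hi => ?_
      rw [Finset.mem_range] at hi
      rw [show j - 1 - i = j - (i + 1) by omega, Nat.cast_sub (by omega)]
      push_cast
      ring
    have h2 : ∏ i ∈ Finset.range l, (y + ((i + 1 : ℕ) : R)) =
        ∏ i ∈ Finset.range l, (y + (((j + i : ℕ) : R) + 1) - j) := by
      refine Finset.prod_congr rfl fun i _ => ?_
      push_cast
      ring
    rw [h1, h2]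
    push_cast
    ring

theorem natDegree_shiftedProd_le (N j : ℕ) :
    (shiftedProd N j (Polynomial.X : Polynomial ℚ)).natDegree ≤ N - 1 := by
  refine (Polynomial.natDegree_prod_le _ _).trans ?_
  refine (Finset.sum_le_card_nsmul _ _ 1 fun i _ => ?_).trans (by simp)
  have : (Polynomial.X + ((i : Polynomial ℚ) + 1) - (j : Polynomial ℚ)) =
      Polynomial.X + Polynomial.C ((i : ℚ) + 1 - j) := by
    simp [add_sub_assoc]
  simp only [this, Polynomial.natDegree_X_add_C, le_refl]

/-- The formula of Katzman for the Ehrhart polynomial of the hypersimplex. -/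
noncomputable def hypersimplexPoly (k N : ℕ) : Polynomial ℚ :=
  ∑ j ∈ Finset.range (k + 1), Polynomial.C ((-1) ^ j * (N.choose j : ℚ) / ((N - 1).factorial : ℚ)) *
    (shiftedProd N j Polynomial.X).comp (Polynomial.C ((k : ℚ) - j) * Polynomial.X)

theorem coeff_hypersimplexPoly (k N m : ℕ) :
    (hypersimplexPoly k N).coeff m = ∑ j ∈ Finset.range (k + 1),
      (-1) ^ j * (N.choose j : ℚ) / ((N - 1).factorial : ℚ) *
        ((shiftedProd N j (Polynomial.X : Polynomial ℚ)).coeff m * ((k : ℚ) - j) ^ m) := by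
  rw [hypersimplexPoly, Polynomial.finsetSum_coeff]
  simp_rw [Polynomial.coeff_C_mul, Polynomial.comp_C_mul_X_coeff]

theorem coeff_hypersimplexPoly_eq_zero {k N m : ℕ} (h : N - 1 < m) :
    (hypersimplexPoly k N).coeff m = 0 := by
  rw [coeff_hypersimplexPoly]
  refine Finset.sum_eq_zero fun j _ => ?_
  rw [Polynomial.coeff_eq_zero_of_natDegree_lt ((natDegree_shiftedProd_le N j).trans_lt h)]
  simp

/-- In the product defining `quotientPow`, the power `x ^ j` occurs only through `(-x) ^ j`, so only
the pair `(j, N - j)` contributes. -/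
theorem coeff_blockSeries_succ {N : ℕ} (hN : 0 < N) (m j : ℕ) (hj : j ≤ N) :
    PowerSeries.coeff j ((1 - PowerSeries.X) ^ (m + 1) * blockSeries (m + 1) N) =
      (-1) ^ j / (j.factorial * (N - j).factorial) *
        (shiftedProd N j (Polynomial.X : Polynomial ℚ)).coeff m := by
  rw [← coeff_coeff_quotientPow, quotientPow, PowerSeries.coeff_mul, Polynomial.finsetSum_coeff,
    map_sum]
  have hterm (p : ℕ × ℕ) (hp : p ∈ Finset.HasAntidiagonal.antidiagonal N) :
      PowerSeries.coeff j ((PowerSeries.coeff p.1 (PowerSeries.mk fun n =>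
        (1 / (n.factorial : ℚ)) • ((-Polynomial.C PowerSeries.X) ^ n *
          ∏ i ∈ Finset.range n, ((Polynomial.X : Polynomial (PowerSeries ℚ)) - i))) *
        PowerSeries.coeff p.2 (PowerSeries.mk fun n => (1 / (n.factorial : ℚ)) •
          ∏ i ∈ Finset.range n, ((Polynomial.X : Polynomial (PowerSeries ℚ)) + i))).coeff (m + 1)) =
      if j = p.1 then (-1) ^ j / (j.factorial * (N - j).factorial) *
        (shiftedProd N j (Polynomial.X : Polynomial ℚ)).coeff m else 0 := by
    rw [Finset.HasAntidiagonal.mem_antidiagonal] at hp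
    have hmap : shiftedProd N p.1 (Polynomial.X : Polynomial (PowerSeries ℚ)) =
        (shiftedProd N p.1 (Polynomial.X : Polynomial ℚ)).map (PowerSeries.C) := by
      simp [shiftedProd, Polynomial.map_prod]
    rw [PowerSeries.coeff_mk, PowerSeries.coeff_mk, smul_mul_smul_comm, mul_assoc,
      prod_sub_mul_prod_add _ _ (by omega), hp, Polynomial.coeff_smul, hmap,
      neg_pow (Polynomial.C (PowerSeries.X : PowerSeries ℚ)), ← Polynomial.C_pow, PowerSeries.coeff_smul, mul_left_comm, Polynomial.coeff_X_mul,
      show ((-1 : Polynomial (PowerSeries ℚ)) ^ p.1) =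
        Polynomial.C (PowerSeries.C ((-1 : ℚ) ^ p.1)) by simp, mul_assoc,
      Polynomial.coeff_C_mul, Polynomial.coeff_C_mul, Polynomial.coeff_map,
      PowerSeries.coeff_C_mul, PowerSeries.coeff_mul_C, PowerSeries.coeff_X_pow]
    split_ifs with h
    · subst h
      rw [show N - p.1 = p.2 by omega, smul_eq_mul]
      ring
    · simp
  rw [Finset.sum_congr rfl hterm, Finset.sum_eq_single (j, N - j)]
  · simp
  · rintro ⟨p, q⟩ hp hne
    rw [Finset.HasAntidiagonal.mem_antidiagonal] at hp
    simp only at hp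
    refine if_neg fun h => hne ?_
    simp only at h
    subst h
    rw [show N - j = q by omega]
  · intro h
    exact absurd (Finset.HasAntidiagonal.mem_antidiagonal.2 (by simp only; omega)) h

/-- Katzman's sum is the convolution of `r ^ m` with the coefficients of `(1 - x) ^ (m + 1) *
blockSeries (m + 1) N`. Moving the power of `1 - x` to the first factor produces Eulerian numbers
and removes all signs. -/
theorem coeff_hypersimplexPoly_eq {k N : ℕ} (hk : k < N) (m : ℕ) :
    (hypersimplexPoly k N).coeff m = N * PowerSeries.coeff k
      ((PowerSeries.mk fun i => (eulerianNum m i : ℚ)) * blockSeries (m + 1) N) := by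
  rw [← mk_pow_mul_one_sub_X_pow, mul_assoc, PowerSeries.coeff_mul, coeff_hypersimplexPoly,
    Finset.Nat.sum_antidiagonal_eq_sum_range_succ_mk, Finset.mul_sum, ← Finset.sum_range_reflect]
  refine Finset.sum_congr rfl fun i hi => ?_
  rw [Finset.mem_range] at hi
  simp only [show k + 1 - 1 - i = k - i by omega]
  have hN : N = N - 1 + 1 := by omega
  rw [PowerSeries.coeff_mk, coeff_blockSeries_succ (by omega) _ _ (by omega),
    Nat.cast_sub (show i ≤ k by omega), sub_sub_cancel, Nat.cast_choose ℚ (by omega)]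
  have h1 : (N.factorial : ℚ) = N * (N - 1).factorial := by
    conv_lhs => rw [hN, Nat.factorial_succ, ← hN]
    push_cast
    ring
  rw [h1]
  have h2 : ((N - 1).factorial : ℚ) ≠ 0 := Nat.cast_ne_zero.2 (Nat.factorial_ne_zero _)
  field_simp

/-- The theorem of Ferroni: hypersimplices are Ehrhart positive. -/
theorem coeff_hypersimplexPoly_pos {k N m : ℕ} (hk0 : 0 < k) (hk : k < N) (hm : m ≤ N - 1) :
    0 < (hypersimplexPoly k N).coeff m := by
  obtain ⟨n, rfl⟩ : ∃ n, N = n + 1 := ⟨N - 1, by omega⟩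
  rw [coeff_hypersimplexPoly_eq hk, PowerSeries.coeff_mul]
  refine mul_pos (by positivity) (Finset.sum_pos' (fun p _ => ?_) ?_)
  · rw [PowerSeries.coeff_mk]
    exact mul_nonneg (Nat.cast_nonneg _) (coeff_blockSeries_nonneg _ _ _)
  -- For `m > 0` the Eulerian number needs `1 ≤ i ≤ m` and the block series needs `k + m - n ≤ i`;
  -- the larger lower bound satisfies everything. For `m = 0` only `i = 0` is available.
  · obtain ⟨i, hik, hpos, hle⟩ : ∃ i ≤ k, 0 < eulerianNum m i ∧ k - i + m ≤ n := by
      rcases Nat.eq_zero_or_pos m with rfl | hm0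
      · exact ⟨0, by omega, by decide, by omega⟩
      · refine ⟨max 1 (k + m - n), by omega, eulerianNum_pos (by omega) (by omega), by omega⟩
    refine ⟨(i, k - i), by rw [Finset.HasAntidiagonal.mem_antidiagonal]; omega, ?_⟩
    rw [PowerSeries.coeff_mk]
    exact mul_pos (Nat.cast_pos.2 hpos)
      (coeff_blockSeries_pos hle (coeff_zero_blockSeries_pos m))

/-! Counting bounded integer vectors with a given sum -/

theorem card_boundedSum_eq_coeff {ι : Type*} [Fintype ι] (t s : ℕ) :
    (Nat.card {x : ι → Fin (t + 1) // ∑ i, (x i : ℕ) = s} : ℚ) =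
      PowerSeries.coeff s
        ((∑ i ∈ Finset.range (t + 1), (PowerSeries.X : PowerSeries ℚ) ^ i) ^ Fintype.card ι) := by
  classical
  rw [Finset.sum_range, ← Finset.card_univ, ← Finset.prod_const, Finset.prod_univ_sum,
    Fintype.piFinset_univ, map_sum]
  simp_rw [Finset.prod_pow_eq_pow_sum, PowerSeries.coeff_X_pow]
  rw [Finset.sum_boole, Nat.card_eq_fintype_card, Fintype.card_subtype]
  simp_rw [eq_comm]

theorem geom_sum_pow_eq (t d : ℕ) :
    (∑ i ∈ Finset.range (t + 1), (PowerSeries.X : PowerSeries ℚ) ^ i) ^ (d + 1) =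
      (1 - PowerSeries.X ^ (t + 1)) ^ (d + 1) *
        PowerSeries.mk fun n => ((d + n).choose d : ℚ) := by
  rw [← mul_neg_geom_sum, mul_pow, mul_right_comm, mul_comm (_ ^ _) (PowerSeries.mk _),
    PowerSeries.mk_add_choose_mul_one_sub_pow_eq_one, one_mul]

/-- The factors are the `d` consecutive integers after `t k - (t + 1) j`. If this number is
negative, one of them is zero, so the cutoff of inclusion–exclusion is built into a polynomial in
`t`. -/
theorem shiftedProd_eq_choose {t k d j : ℕ} (hj : j ≤ k) (hk : k < d + 1) :
    shiftedProd (d + 1) j (((k : ℚ) - j) * t) =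
      if (t + 1) * j ≤ t * k then
        (d.factorial : ℚ) * ((d + (t * k - (t + 1) * j)).choose d : ℚ) else 0 := by
  rw [shiftedProd, Nat.add_sub_cancel]
  split_ifs with h
  · obtain ⟨e, he⟩ := Nat.exists_eq_add_of_le h
    have heq : ((t : ℚ) * k) = (t + 1) * j + e := by exact_mod_cast he
    rw [he, Nat.add_sub_cancel_left, add_comm d e, ← Nat.cast_mul,
      ← Nat.ascFactorial_eq_factorial_mul_choose, Nat.ascFactorial_eq_prod_range, Nat.cast_prod]
    refine Finset.prod_congr rfl fun i _ => ?_
    push_cast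
    linear_combination heq
  · rw [not_le] at h
    obtain ⟨e, he⟩ := Nat.exists_eq_add_of_lt h
    have heq : ((t : ℚ) + 1) * j = t * k + e + 1 := by exact_mod_cast he
    have hjk := Nat.mul_le_mul_left t hj
    refine Finset.prod_eq_zero (i := e) ?_ ?_
    · rw [Finset.mem_range]
      rw [Nat.add_mul, Nat.one_mul] at he
      omega
    · linear_combination -heq

theorem card_boundedSum {ι : Type*} [Fintype ι] {k t : ℕ} (hk : k < Fintype.card ι) :
    (Nat.card {x : ι → Fin (t + 1) // ∑ i, (x i : ℕ) = t * k} : ℚ) =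
      (hypersimplexPoly k (Fintype.card ι)).eval (t : ℚ) := by
  rw [card_boundedSum_eq_coeff]
  obtain ⟨d, hd⟩ : ∃ d, Fintype.card ι = d + 1 := ⟨Fintype.card ι - 1, by omega⟩
  rw [hd] at hk ⊢
  rw [geom_sum_pow_eq, sub_eq_neg_add, add_pow, Finset.sum_mul, map_sum, hypersimplexPoly,
    Polynomial.eval_finsetSum]
  have hterm (j : ℕ) : PowerSeries.coeff (t * k) ((-PowerSeries.X ^ (t + 1)) ^ j *
      1 ^ (d + 1 - j) * ((d + 1).choose j : PowerSeries ℚ) *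
        PowerSeries.mk fun n => ((d + n).choose d : ℚ)) =
      (-1) ^ j * ((d + 1).choose j : ℚ) * if (t + 1) * j ≤ t * k then
        ((d + (t * k - (t + 1) * j)).choose d : ℚ) else 0 := by
    rw [neg_pow, one_pow, mul_one, ← pow_mul, show ((-1 : PowerSeries ℚ) ^ j *
      PowerSeries.X ^ ((t + 1) * j) * ((d + 1).choose j : PowerSeries ℚ) *
        PowerSeries.mk fun n => ((d + n).choose d : ℚ)) =
      PowerSeries.C ((-1) ^ j * ((d + 1).choose j : ℚ)) * (PowerSeries.X ^ ((t + 1) * j) *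
        PowerSeries.mk fun n => ((d + n).choose d : ℚ)) by
      simp only [map_mul, map_pow, map_neg, map_one, map_natCast]; ring,
      PowerSeries.coeff_C_mul, PowerSeries.coeff_X_pow_mul']
    simp
  simp_rw [hterm]
  symm
  -- For `j > k` one has `t k < (t + 1) j`, so the terms beyond `k` vanish.
  rw [← Finset.sum_subset (Finset.range_mono (show k + 1 ≤ d + 1 + 1 by omega))]
  · refine Finset.sum_congr rfl fun j hj => ?_
    rw [Finset.mem_range] at hj
    have h1 := shiftedProd_eq_choose (t := t) (show j ≤ k by omega) hk
    have h2 : (shiftedProd (d + 1) j (Polynomial.X : Polynomial ℚ)).eval (((k : ℚ) - j) * t) =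
        shiftedProd (d + 1) j (((k : ℚ) - j) * t) := by
      simp [shiftedProd, Polynomial.eval_prod]
    have h3 : (d.factorial : ℚ) ≠ 0 := Nat.cast_ne_zero.2 (Nat.factorial_ne_zero _)
    simp only [Polynomial.eval_mul, Polynomial.eval_C, Polynomial.eval_comp, Polynomial.eval_X,
      Nat.add_sub_cancel]
    rw [h2, h1]
    split_ifs
    · field_simp
    · simp
  · intro j _ hj
    rw [Finset.mem_range] at hj
    rw [if_neg, mul_zero]
    rw [not_le]
    have := Nat.mul_le_mul_left t (show k ≤ j by omega)
    rw [Nat.add_mul, Nat.one_mul]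
    omega

/-! Lattice points of dilated matroid polytopes -/

/-- `x` is the sum of the indicator vectors of `t` bases of `M`. -/
def IsBaseSum {α : Type*} (M : Matroid α) (t : ℕ) (x : α → ℤ) : Prop :=
  ∃ B : Fin t → Set α, (∀ s, M.IsBase (B s)) ∧ ∀ i, x i = ∑ s, (B s).indicator 1 i

theorem IsBaseSum.mem_smul {α : Type*} {M : Matroid α} {t : ℕ} (ht : 0 < t) {x : α → ℤ}
    (hx : IsBaseSum M t x) : (fun i => (x i : ℝ)) ∈ (t : ℝ) • matroidPolytope M := by
  obtain ⟨B, hB, hxB⟩ := hx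
  have ht' : (t : ℝ) ≠ 0 := by positivity
  refine Set.mem_smul_set.2 ⟨∑ s, (1 / (t : ℝ)) • (B s).indicator 1, ?_, ?_⟩
  · refine (convex_convexHull ℝ _).sum_mem (fun _ _ => by positivity) ?_
      fun s _ => subset_convexHull ℝ _ ⟨B s, hB s, rfl⟩
    rw [Finset.sum_const, Finset.card_univ, Fintype.card_fin, nsmul_eq_mul]
    field_simp
  · rw [← Finset.smul_sum, smul_smul, mul_one_div_cancel ht', one_smul]
    ext i
    rw [hxB, Finset.sum_apply, Int.cast_sum]
    refine Finset.sum_congr rfl fun s _ => ?_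
    by_cases h : i ∈ B s <;> simp [h]

/-- A linear inequality valid at the vertices holds on the hull and scales with `t`. The factor `e`
is a sign: `1` yields lower bounds and `-1` upper bounds. -/
theorem le_sum_of_mem_smul {α : Type*} {M : Matroid α} {t : ℕ} {x : α → ℤ}
    (hx : (fun i => (x i : ℝ)) ∈ (t : ℝ) • matroidPolytope M) (F : Finset α) (e c : ℤ)
    (hc : ∀ B : Set α, M.IsBase B → c ≤ e * ∑ i ∈ F, B.indicator 1 i) :
    t * c ≤ e * ∑ i ∈ F, x i := by
  obtain ⟨v, hv, hvx⟩ := Set.mem_smul_set.1 hx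
  have hsub : matroidPolytope M ⊆ {v | (c : ℝ) ≤ (e : ℝ) * ∑ i ∈ F, v i} := by
    refine convexHull_min ?_ ?_
    · rintro _ ⟨B, hB, rfl⟩
      have := hc B hB
      have hcast : ((∑ i ∈ F, B.indicator 1 i : ℤ) : ℝ) = ∑ i ∈ F, B.indicator (1 : α → ℝ) i := by
        rw [Int.cast_sum]
        refine Finset.sum_congr rfl fun i _ => ?_
        by_cases h : i ∈ B <;> simp [h]
      rw [Set.mem_ofPred_eq, ← hcast]
      exact_mod_cast this
    · refine convex_halfSpace_ge ⟨fun u w => ?_, fun r u => ?_⟩ _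
      · simp only [Pi.add_apply, Finset.sum_add_distrib, mul_add]
      · simp only [Pi.smul_apply, smul_eq_mul, ← Finset.mul_sum]
        ring
  have h1 : (c : ℝ) ≤ (e : ℝ) * ∑ i ∈ F, v i := hsub hv
  have h2 : ((e * ∑ i ∈ F, x i : ℤ) : ℝ) = t * (e * ∑ i ∈ F, v i) := by
    push_cast
    rw [mul_left_comm, Finset.mul_sum (a := (t : ℝ))]
    congr 1
    exact Finset.sum_congr rfl fun i _ => (congrFun hvx i).symm
  have h3 : (t : ℝ) * c ≤ ((e * ∑ i ∈ F, x i : ℤ) : ℝ) := by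
    rw [h2]
    exact mul_le_mul_of_nonneg_left h1 (Nat.cast_nonneg t)
  exact_mod_cast h3

theorem sum_eq_of_mem_smul {α : Type*} {M : Matroid α} {t : ℕ} {x : α → ℤ}
    (hx : (fun i => (x i : ℝ)) ∈ (t : ℝ) • matroidPolytope M) (F : Finset α) (c : ℤ)
    (hc : ∀ B : Set α, M.IsBase B → ∑ i ∈ F, B.indicator 1 i = c) :
    ∑ i ∈ F, x i = t * c := by
  have h1 := le_sum_of_mem_smul hx F 1 c fun B hB => by rw [hc B hB, one_mul]
  have h2 := le_sum_of_mem_smul hx F (-1) (-c) fun B hB => by rw [hc B hB]; omega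
  rw [mul_neg] at h2
  omega

theorem bounds_of_mem_smul {α : Type*} {M : Matroid α} {t : ℕ} {x : α → ℤ}
    (hx : (fun i => (x i : ℝ)) ∈ (t : ℝ) • matroidPolytope M) (i : α) :
    0 ≤ x i ∧ x i ≤ t := by
  have h1 := le_sum_of_mem_smul hx {i} 1 0 fun B _ => by
    by_cases h : i ∈ B <;> simp [h]
  have h2 := le_sum_of_mem_smul hx {i} (-1) (-1) fun B _ => by
    by_cases h : i ∈ B <;> simp [h]
  simp at h1 h2
  omega

/-! ### Rounding prefix sums: integer decomposition -/

/-- The sum of the entries of `x` in the positions before `J`. -/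
def prefixSum {N : ℕ} (x : Fin N → ℕ) (J : ℕ) : ℕ :=
  ∑ i with i.val < J, x i

theorem prefixSum_zero {N : ℕ} (x : Fin N → ℕ) : prefixSum x 0 = 0 := by
  simp [prefixSum]

theorem prefixSum_succ {N : ℕ} (x : Fin N → ℕ) (i : Fin N) :
    prefixSum x (i + 1) = prefixSum x i + x i := by
  have : (Finset.univ.filter fun j : Fin N => j.val < i + 1) =
      insert i (Finset.univ.filter fun j : Fin N => j.val < i) := by
    ext j
    simp only [Finset.mem_filter, Finset.mem_univ, true_and, Finset.mem_insert, Fin.ext_iff]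
    omega
  rw [prefixSum, this, Finset.sum_insert (by simp), add_comm, prefixSum]

theorem prefixSum_self {N : ℕ} (x : Fin N → ℕ) : prefixSum x N = ∑ i, x i := by
  simp [prefixSum]

theorem prefixSum_mono {N : ℕ} (x : Fin N → ℕ) : Monotone (prefixSum x) := by
  intro J K h
  refine Finset.sum_le_sum_of_subset fun i => ?_
  simp only [Finset.mem_filter, Finset.mem_univ, true_and]
  omega

theorem prefixSum_add_le {N t : ℕ} {x : Fin N → ℕ} (hx : ∀ i, x i ≤ t) {J d : ℕ}
    (h : J + d ≤ N) : prefixSum x (J + d) ≤ prefixSum x J + t * d := by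
  induction d with
  | zero => simp
  | succ d ih =>
    have h1 := prefixSum_succ x ⟨J + d, by omega⟩
    have h2 := hx ⟨J + d, by omega⟩
    have h3 := ih (by omega)
    simp only at h1
    rw [← add_assoc, h1, Nat.mul_add, Nat.mul_one]
    omega

/-- Hermite's identity: passing from `m` to `m + 1` replaces the term `m / t` by `(m + t) / t`, one
more. -/
theorem sum_add_div {t : ℕ} (ht : 0 < t) (m : ℕ) : ∑ s ∈ Finset.range t, (m + s) / t = m := by
  induction m with
  | zero =>
    refine Finset.sum_eq_zero fun s hs => ?_
    rw [zero_add]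
    exact Nat.div_eq_of_lt (Finset.mem_range.1 hs)
  | succ m ih =>
    have h1 := Finset.sum_range_succ (fun s => (m + s) / t) t
    have h2 := Finset.sum_range_succ' (fun s => (m + s) / t) t
    rw [h1, ih, Nat.add_div_right m ht, add_zero] at h2
    have h3 : ∑ s ∈ Finset.range t, (m + 1 + s) / t = ∑ s ∈ Finset.range t, (m + (s + 1)) / t :=
      Finset.sum_congr rfl fun s _ => by rw [add_assoc, add_comm 1 s]
    rw [h3]
    omega

theorem card_jumps {N : ℕ} {Z : ℕ → ℕ} (h0 : Z 0 = 0)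
    (hZ : ∀ J < N, Z (J + 1) = Z J + if Z J < Z (J + 1) then 1 else 0) {J : ℕ} (hJ : J ≤ N) :
    ((Finset.univ.filter fun i : Fin N => Z i < Z (i + 1)).filter (·.val < J)).card = Z J := by
  induction J with
  | zero => simp [h0]
  | succ J ih =>
    rw [hZ J hJ, ← ih (by omega)]
    by_cases h : Z J < Z (J + 1)
    · have h2 : (Finset.univ.filter fun i : Fin N => Z i < Z (i + 1)).filter (·.val < J + 1) =
          insert ⟨J, hJ⟩
            ((Finset.univ.filter fun i : Fin N => Z i < Z (i + 1)).filter (·.val < J)) := by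
        ext i
        simp only [Finset.mem_filter, Finset.mem_univ, true_and, Finset.mem_insert, Fin.ext_iff]
        constructor
        · rintro ⟨h1, h2⟩
          by_cases hi : i.val = J
          · exact Or.inl hi
          · exact Or.inr ⟨h1, by omega⟩
        · rintro (h1 | h1)
          · rw [h1]
            exact ⟨h, by omega⟩
          · exact ⟨h1.1, by omega⟩
      rw [h2, Finset.card_insert_of_notMem (by simp), ih (by omega), if_pos h]
    · have h2 : (Finset.univ.filter fun i : Fin N => Z i < Z (i + 1)).filter (·.val < J + 1) =
          (Finset.univ.filter fun i : Fin N => Z i < Z (i + 1)).filter (·.val < J) := by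
        refine Finset.filter_congr fun i hi => ?_
        have hne : i.val ≠ J := by
          intro hi'
          rw [Finset.mem_filter, hi'] at hi
          exact h hi.2
        omega
      rw [h2, ih (by omega), if_neg h, add_zero]

/-- `B s` collects the positions where `(prefixSum x J + s) / t` jumps. Entries are at most `t`, so
jumps have size one and the count before `J` telescopes; summing over `s` recovers `x` by Hermite's
identity. -/
theorem exists_rounding {N t : ℕ} (ht : 0 < t) {x : Fin N → ℕ} (hx : ∀ i, x i ≤ t) :
    ∃ B : Fin t → Finset (Fin N), (∀ i, x i = ∑ s, if i ∈ B s then 1 else 0) ∧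
      ∀ s, ∀ J ≤ N, ((B s).filter (·.val < J)).card = (prefixSum x J + s) / t := by
  have hstep (i : Fin N) (s : ℕ) : (prefixSum x (i + 1) + s) / t = (prefixSum x i + s) / t +
      if (prefixSum x i + s) / t < (prefixSum x (i + 1) + s) / t then 1 else 0 := by
    have h1 : (prefixSum x i + s) / t ≤ (prefixSum x (i + 1) + s) / t := by
      rw [prefixSum_succ]
      exact Nat.div_le_div_right (by omega)
    have h2 : (prefixSum x (i + 1) + s) / t ≤ (prefixSum x i + s) / t + 1 := by
      rw [prefixSum_succ, ← Nat.add_div_right _ ht]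
      exact Nat.div_le_div_right (by have := hx i; omega)
    split_ifs <;> omega
  refine ⟨fun s => Finset.univ.filter fun i =>
    (prefixSum x i + s) / t < (prefixSum x (i + 1) + s) / t, fun i => ?_, fun s J hJ => ?_⟩
  · have h1 := sum_add_div ht (prefixSum x i)
    have h2 := sum_add_div ht (prefixSum x (i + 1))
    rw [Finset.sum_range] at h1 h2
    rw [Finset.sum_congr rfl fun (s : Fin t) _ => hstep i s, Finset.sum_add_distrib, h1] at h2
    rw [prefixSum_succ x i] at h2
    simp only [Finset.mem_filter, Finset.mem_univ, true_and]
    rw [prefixSum_succ x i]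
    exact (Nat.add_left_cancel h2).symm
  · refine card_jumps (Z := fun J => (prefixSum x J + s) / t) ?_ (fun J hJ => ?_) hJ
    · rw [prefixSum_zero, zero_add, Nat.div_eq_of_lt s.2]
    · exact hstep ⟨J, hJ⟩ s

theorem latticeCount_eq {α : Type*} (P : Set (α → ℝ)) (t : ℕ) :
    latticeCount P t = Nat.card {x : α → ℤ // (fun i => (x i : ℝ)) ∈ (t : ℝ) • P} :=
  (Nat.card_coe_set_eq _).symm

/-- The lattice points of `t P`, as vectors with entries in `{0, …, t}`. -/
theorem latticeCount_eq_card {α : Type*} {M : Matroid α} {t : ℕ} {Q : (α → ℕ) → Prop}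
    (hQ : ∀ x : α → ℕ, (∀ i, x i ≤ t) →
      ((fun i => ((x i : ℤ) : ℝ)) ∈ (t : ℝ) • matroidPolytope M ↔ Q x)) :
    latticeCount (matroidPolytope M) t =
      Nat.card {x : α → Fin (t + 1) // Q fun i => x i} := by
  rw [latticeCount_eq]
  refine (Nat.card_congr (Equiv.ofBijective (fun x => ⟨fun i => ((x.1 i : ℕ) : ℤ),
    (hQ _ fun i => Nat.lt_succ_iff.1 (x.1 i).2).2 x.2⟩) ⟨?_, ?_⟩)).symm
  · rintro ⟨x, hx⟩ ⟨y, hy⟩ hxy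
    simp only [Subtype.mk.injEq] at hxy ⊢
    ext i
    exact_mod_cast congrFun hxy i
  · rintro ⟨x, hx⟩
    have hb := bounds_of_mem_smul hx
    have hnat (i : α) : (((x i).toNat : ℕ) : ℤ) = x i := Int.toNat_of_nonneg (hb i).1
    refine ⟨⟨fun i => ⟨(x i).toNat, by have := hb i; omega⟩, ?_⟩, ?_⟩
    · refine (hQ _ fun i => ?_).1 ?_
      · have := hb i
        simp only
        omega
      · simp only [hnat]
        exact hx
    · simp only [hnat]

/-! Uniform matroids -/

theorem uniformMatroid_isBase_iff {k N : ℕ} (hk : k ≤ N) (B : Set (Fin N)) :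
    (uniformMatroid k N).IsBase B ↔ B.ncard = k := by
  have hindep (I : Set (Fin N)) : (uniformMatroid k N).Indep I ↔ I.ncard ≤ k := by
    simp [uniformMatroid]
  rw [Matroid.isBase_iff_maximal_indep, maximal_iff]
  simp only [hindep]
  constructor
  · rintro ⟨h, hmax⟩
    by_contra hne
    obtain ⟨e, -, he⟩ := Set.exists_mem_notMem_of_ncard_lt_ncard (s := B) (t := Set.univ)
      (by rw [Set.ncard_univ, Nat.card_fin]; omega)
    have hins : B = insert e B := hmax (by rw [Set.ncard_insert_of_notMem he]; omega)
      (Set.subset_insert _ _)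
    exact he (hins ▸ Set.mem_insert e B)
  · rintro rfl
    exact ⟨le_rfl, fun I hI hBI => Set.eq_of_subset_of_ncard_le hBI hI⟩

theorem sum_indicator_coe {α : Type*} [DecidableEq α] (F T : Finset α) :
    ∑ i ∈ F, (T : Set α).indicator (1 : α → ℤ) i = ((F ∩ T).card : ℤ) := by
  simp [Set.indicator_apply, Finset.sum_ite_mem]

/-- Each rounded set has `(t * k + s) / t = k` elements, because `s < t`. -/
theorem isBaseSum_uniformMatroid {k N t : ℕ} (hk : k ≤ N) (ht : 0 < t) {x : Fin N → ℕ}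
    (hx : ∀ i, x i ≤ t) (hsum : ∑ i, x i = t * k) :
    IsBaseSum (uniformMatroid k N) t fun i => x i := by
  obtain ⟨B, hB, hcard⟩ := exists_rounding ht hx
  refine ⟨fun s => B s, fun s => ?_, fun i => ?_⟩
  · have h := hcard s N le_rfl
    rw [Finset.filter_true_of_mem fun i _ => i.2, prefixSum_self, hsum,
      Nat.mul_add_div ht, Nat.div_eq_of_lt s.2, add_zero] at h
    rw [uniformMatroid_isBase_iff hk, Set.ncard_coe_finset, h]
  · simp only [hB i]
    push_cast
    simp [Set.indicator_apply]

theorem mem_smul_uniformMatroid_iff {k N t : ℕ} (hk : k ≤ N) (ht : 0 < t) {x : Fin N → ℕ}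
    (hx : ∀ i, x i ≤ t) :
    (fun i => ((x i : ℤ) : ℝ)) ∈ (t : ℝ) • matroidPolytope (uniformMatroid k N) ↔
      ∑ i, x i = t * k := by
  refine ⟨fun h => ?_, fun h => (isBaseSum_uniformMatroid hk ht hx h).mem_smul ht⟩
  have := sum_eq_of_mem_smul h Finset.univ k fun B hB => by
    classical
    rw [uniformMatroid_isBase_iff hk, Set.ncard_eq_toFinset_card'] at hB
    rw [← Set.coe_toFinset B, sum_indicator_coe, Finset.univ_inter, hB]
  exact_mod_cast this

theorem latticeCount_uniformMatroid {k N t : ℕ} (hk : k ≤ N) (ht : 0 < t) :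
    latticeCount (matroidPolytope (uniformMatroid k N)) t =
      Nat.card {x : Fin N → Fin (t + 1) // ∑ i, (x i : ℕ) = t * k} :=
  latticeCount_eq_card (Q := fun x => ∑ i, x i = t * k)
    fun _ hx => mem_smul_uniformMatroid_iff hk ht hx

theorem isEhrhartPolynomial_uniformMatroid {k N : ℕ} (hk : k < N) :
    IsEhrhartPolynomial (matroidPolytope (uniformMatroid k N)) (hypersimplexPoly k N) := by
  intro t ht
  have h := card_boundedSum (ι := Fin N) (k := k) (t := t) (by simpa using hk)
  rw [Fintype.card_fin] at h
  rw [latticeCount_uniformMatroid hk.le ht, h]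

/-! Direct sums -/

/-- Restriction to a summand is linear and sends bases to bases. Conversely, the integer
decompositions of the components have the same length `t`, so their `s`-th bases can be glued. -/
theorem mem_smul_sigma_iff {ι : Type*} {α : ι → Type*} {M : (i : ι) → Matroid (α i)} {t : ℕ}
    (ht : 0 < t)
    (hM : ∀ i, ∀ x : α i → ℤ, (fun j => (x j : ℝ)) ∈ (t : ℝ) • matroidPolytope (M i) →
      IsBaseSum (M i) t x) (x : ((i : ι) × α i) → ℤ) :
    (fun p => (x p : ℝ)) ∈ (t : ℝ) • matroidPolytope (Matroid.sigma M) ↔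
      ∀ i, (fun j => (x ⟨i, j⟩ : ℝ)) ∈ (t : ℝ) • matroidPolytope (M i) := by
  constructor
  · intro hx i
    obtain ⟨v, hv, hvx⟩ := Set.mem_smul_set.1 hx
    refine Set.mem_smul_set.2 ⟨fun j => v ⟨i, j⟩, ?_, funext fun j => congrFun hvx ⟨i, j⟩⟩
    have hsub : matroidPolytope (Matroid.sigma M) ⊆
        LinearMap.funLeft ℝ ℝ (Sigma.mk i) ⁻¹' matroidPolytope (M i) := by
      refine convexHull_min ?_ ((convex_convexHull ℝ _).linear_preimage _)
      rintro _ ⟨B, hB, rfl⟩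
      exact subset_convexHull ℝ _ ⟨_, Matroid.sigma_isBase_iff.1 hB i, rfl⟩
    exact hsub hv
  · intro hx
    choose B hB hxB using fun i => hM i (fun j => x ⟨i, j⟩) (hx i)
    refine IsBaseSum.mem_smul ht ⟨fun s => {p | p.2 ∈ B p.1 s}, fun s => ?_, fun p => ?_⟩
    · exact Matroid.sigma_isBase_iff.2 fun i => hB i s
    · exact hxB p.1 p.2

theorem latticeCount_sigma {ι : Type*} [Fintype ι] {α : ι → Type*} {M : (i : ι) → Matroid (α i)}
    {t : ℕ} (ht : 0 < t)
    (hM : ∀ i, ∀ x : α i → ℤ, (fun j => (x j : ℝ)) ∈ (t : ℝ) • matroidPolytope (M i) →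
      IsBaseSum (M i) t x) :
    latticeCount (matroidPolytope (Matroid.sigma M)) t =
      ∏ i, latticeCount (matroidPolytope (M i)) t := by
  simp only [latticeCount_eq]
  rw [← Nat.card_pi]
  exact Nat.card_congr (((Equiv.piCurry fun _ _ => ℤ).subtypeEquiv
    fun x => mem_smul_sigma_iff ht hM x).trans (Equiv.subtypePiEquivPi
      (p := fun i (x : α i → ℤ) => (fun j => (x j : ℝ)) ∈ (t : ℝ) • matroidPolytope (M i))))

theorem isBaseSum_of_mem_smul_uniformMatroid {k N t : ℕ} (hk : k ≤ N) (ht : 0 < t)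
    (x : Fin N → ℤ)
    (hx : (fun i => (x i : ℝ)) ∈ (t : ℝ) • matroidPolytope (uniformMatroid k N)) :
    IsBaseSum (uniformMatroid k N) t x := by
  have hb := bounds_of_mem_smul hx
  lift x to Fin N → ℕ using fun i => (hb i).1
  have hx' : ∀ i, x i ≤ t := fun i => Int.ofNat_le.1 (hb i).2
  exact isBaseSum_uniformMatroid hk ht hx' ((mem_smul_uniformMatroid_iff hk ht hx').1 hx)

/-! Catalan matroids -/

theorem schubertMatroid_isBase_iff {N : ℕ} (S : Finset (Fin N)) (B : Set (Fin N)) :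
    (schubertMatroid S).IsBase B ↔ ∃ T : Finset (Fin N), (T : Set (Fin N)) = B ∧
      T.card = S.card ∧
        ∀ J ≤ N, (S.filter (·.val < J)).card ≤ (T.filter (·.val < J)).card := by
  have h1 : (schubertMatroid S).IsBase B ↔ ∃ T : Finset (Fin N), (T : Set (Fin N)) = B ∧
      GaleLE T S := by
    simp [schubertMatroid]
  have h2 (T : Finset (Fin N)) (j : Fin N) :
      T.filter (· ≤ j) = T.filter (·.val < j.val + 1) :=
    Finset.filter_congr fun i _ => by rw [Nat.lt_succ_iff, Fin.le_def]
  rw [h1]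
  refine exists_congr fun T => and_congr_right fun _ => ?_
  rw [galeLE_iff]
  refine and_congr_right fun _ => ⟨fun h J hJ => ?_, fun h j => ?_⟩
  · rcases J with _ | J
    · simp
    · have := h ⟨J, hJ⟩
      rwa [h2, h2] at this
  · rw [h2, h2]
    exact h _ j.2

/-- A lower bound `t * c` on a prefix sum survives rounding as the lower bound `c` on each `B s`. -/
theorem isBaseSum_schubertMatroid {N t : ℕ} {S : Finset (Fin N)} (ht : 0 < t) {x : Fin N → ℕ}
    (hx : ∀ i, x i ≤ t) (hsum : ∑ i, x i = t * S.card)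
    (hprefix : ∀ J ≤ N, t * (S.filter (·.val < J)).card ≤ prefixSum x J) :
    IsBaseSum (schubertMatroid S) t fun i => x i := by
  obtain ⟨B, hB, hcard⟩ := exists_rounding ht hx
  refine ⟨fun s => B s, fun s => ?_, fun i => ?_⟩
  · rw [schubertMatroid_isBase_iff]
    refine ⟨B s, rfl, ?_, fun J hJ => ?_⟩
    · have h := hcard s N le_rfl
      rwa [Finset.filter_true_of_mem fun i _ => i.2, prefixSum_self, hsum,
        Nat.mul_add_div ht, Nat.div_eq_of_lt s.2, add_zero] at h
    · rw [hcard s J hJ, Nat.le_div_iff_mul_le ht, mul_comm]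
      exact (hprefix J hJ).trans (Nat.le_add_right _ _)
  · simp only [hB i]
    push_cast
    simp [Set.indicator_apply]

theorem mem_smul_schubertMatroid_iff {N t : ℕ} {S : Finset (Fin N)} (ht : 0 < t) {x : Fin N → ℕ}
    (hx : ∀ i, x i ≤ t) :
    (fun i => ((x i : ℤ) : ℝ)) ∈ (t : ℝ) • matroidPolytope (schubertMatroid S) ↔
      ∑ i, x i = t * S.card ∧
        ∀ J ≤ N, t * (S.filter (·.val < J)).card ≤ prefixSum x J := by
  refine ⟨fun h => ⟨?_, fun J hJ => ?_⟩,
    fun h => (isBaseSum_schubertMatroid ht hx h.1 h.2).mem_smul ht⟩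
  · have := sum_eq_of_mem_smul h Finset.univ S.card fun B hB => by
      obtain ⟨T, rfl, hT, -⟩ := (schubertMatroid_isBase_iff S B).1 hB
      rw [sum_indicator_coe, Finset.univ_inter, hT]
    exact_mod_cast this
  · have := le_sum_of_mem_smul h (Finset.univ.filter (·.val < J)) 1
      ((S.filter (·.val < J)).card : ℤ) fun B hB => by
      obtain ⟨T, rfl, -, hT⟩ := (schubertMatroid_isBase_iff S B).1 hB
      rw [sum_indicator_coe, one_mul, Finset.filter_inter, Finset.univ_inter]
      exact_mod_cast hT J hJ
    rw [one_mul] at this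
    exact_mod_cast this

theorem count_block (a b r : ℕ) (hr : r ≤ a + b) :
    Nat.count (fun i => a ≤ i % (a + b)) r = r - a := by
  induction r with
  | zero => simp
  | succ r ih =>
    rw [Nat.count_succ, ih (by omega), Nat.mod_eq_of_lt hr]
    split_ifs <;> omega

theorem count_blocks (a b q r : ℕ) (hr : r ≤ a + b) :
    Nat.count (fun i => a ≤ i % (a + b)) (q * (a + b) + r) = q * b + (r - a) := by
  have hadd (q r : ℕ) : Nat.count (fun i => a ≤ i % (a + b)) (q * (a + b) + r) =
      Nat.count (fun i => a ≤ i % (a + b)) (q * (a + b)) +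
        Nat.count (fun i => a ≤ i % (a + b)) r := by
    rw [Nat.count_add]
    simp_rw [Nat.mul_add_mod_self_right]
  have hq : Nat.count (fun i => a ≤ i % (a + b)) (q * (a + b)) = q * b := by
    induction q with
    | zero => simp
    | succ q ih =>
      rw [Nat.add_mul, Nat.one_mul, hadd, ih, count_block a b _ le_rfl, Nat.add_mul, Nat.one_mul]
      omega
  rw [hadd, hq, count_block a b r hr]

theorem card_filter_filter_lt {N J : ℕ} (hJ : J ≤ N) (p : ℕ → Prop) [DecidablePred p] :
    ((Finset.univ.filter fun i : Fin N => p i).filter (·.val < J)).card = Nat.count p J := by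
  rw [Nat.count_eq_card_filter_range, ← Finset.card_map Fin.valEmbedding]
  congr 1
  ext i
  simp only [Finset.mem_map, Finset.mem_filter, Finset.mem_univ, true_and, Fin.valEmbedding_apply,
    Finset.mem_range]
  constructor
  · rintro ⟨j, ⟨h1, h2⟩, rfl⟩
    exact ⟨h2, h1⟩
  · rintro ⟨h1, h2⟩
    exact ⟨⟨i, by omega⟩, ⟨h2, h1⟩, rfl⟩

/-- Only the ends of the blocks matter for the prefix inequalities. -/
theorem prefix_le_iff {a b n t : ℕ} (hab : 0 < a + b) {x : Fin (n * (a + b)) → ℕ}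
    (hx : ∀ i, x i ≤ t) :
    (∀ J ≤ n * (a + b), t * Nat.count (fun i => a ≤ i % (a + b)) J ≤ prefixSum x J) ↔
      ∀ q ≤ n, q * (t * b) ≤ prefixSum x (q * (a + b)) := by
  constructor
  · intro h q hq
    have := h (q * (a + b)) (Nat.mul_le_mul_right _ hq)
    rwa [← add_zero (q * (a + b)), count_blocks a b q 0 (by omega), Nat.zero_sub, add_zero,
      add_zero, mul_left_comm] at this
  · intro h J hJ
    obtain ⟨q, r, hr, rfl⟩ : ∃ q r, r < a + b ∧ J = q * (a + b) + r :=
      ⟨J / (a + b), J % (a + b), Nat.mod_lt _ hab, by rw [mul_comm, Nat.div_add_mod]⟩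
    have hqn : q * (a + b) ≤ n * (a + b) := by omega
    rw [count_blocks a b q r hr.le]
    -- Inside the run of ones, go back from the end of the block: the `a + b - r` missing entries
    -- are at most `t` each, exactly the amount by which the bound is lower. Inside the run of zeros
    -- the bound is that of the block's start, and prefix sums are monotone.
    rcases Nat.lt_or_ge a r with har | har
    · have hqn' : q < n := by
        by_contra hge
        have := Nat.mul_le_mul_right (a + b) (not_lt.1 hge)
        omega
      have h1 := h (q + 1) hqn'
      have h2 := Nat.mul_le_mul_right (a + b) (show q + 1 ≤ n from hqn')
      have h3 : (q + 1) * (a + b) = q * (a + b) + r + (a + b - r) := by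
        rw [Nat.add_mul, Nat.one_mul]
        omega
      rw [h3] at h1 h2
      have h4 := prefixSum_add_le hx h2
      have h5 : t * (q * b + (r - a)) + t * (a + b - r) = (q + 1) * (t * b) := by
        rw [← Nat.mul_add, show q * b + (r - a) + (a + b - r) = q * b + b by omega]
        ring
      omega
    · rw [Nat.sub_eq_zero_of_le har, add_zero, mul_left_comm]
      exact (h q (Nat.le_of_mul_le_mul_right hqn hab)).trans
        (prefixSum_mono x (Nat.le_add_right _ _))

theorem latticeCount_catalanMatroid {a b n t : ℕ} (hab : 0 < a + b) (ht : 0 < t) :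
    latticeCount (matroidPolytope (catalanMatroid a b n)) t =
      Nat.card {x : Fin (n * (a + b)) → Fin (t + 1) // ∑ i, (x i : ℕ) = n * (t * b) ∧
        ∀ q ≤ n, q * (t * b) ≤ prefixSum (fun i => (x i : ℕ)) (q * (a + b))} := by
  refine latticeCount_eq_card (Q := fun x => ∑ i, x i = n * (t * b) ∧
    ∀ q ≤ n, q * (t * b) ≤ prefixSum x (q * (a + b))) fun x hx => ?_
  have hS : (Finset.univ.filter fun i : Fin (n * (a + b)) => a ≤ (i : ℕ) % (a + b)).card =
      n * b := by
    have h := card_filter_filter_lt (le_refl (n * (a + b))) fun i => a ≤ i % (a + b)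
    rw [Finset.filter_true_of_mem fun i _ => i.2] at h
    rw [h, ← add_zero (n * (a + b)), count_blocks a b n 0 (by omega), Nat.zero_sub, add_zero]
  rw [catalanMatroid, mem_smul_schubertMatroid_iff ht hx, hS, mul_left_comm, ← prefix_le_iff hab hx]
  refine and_congr_right fun _ => forall₂_congr fun J hJ => ?_
  rw [card_filter_filter_lt hJ fun i => a ≤ i % (a + b)]

/-! Lattice points as walks -/

/-- The height of a block of entries, normalized so that the blocks of a lattice point of the
Catalan matroid polytope form an excursion. -/
def blockHeight (c t d : ℕ) (x : Fin c → Fin (t + 1)) : ℤ :=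
  ((∑ i, (x i : ℕ) : ℕ) : ℤ) - d

theorem walkSum_take_ofFn {α : Type*} {n : ℕ} (h : α → ℤ) (y : Fin n → α) (q : ℕ) :
    walkSum h ((List.ofFn y).take q) = ∑ j with j.val < q, h (y j) := by
  rw [walkSum, List.map_take, List.map_ofFn, List.sum_take_ofFn]
  rfl

theorem card_filter_val_lt {n q : ℕ} (hq : q ≤ n) :
    (Finset.univ.filter fun j : Fin n => j.val < q).card = q := by
  have := card_filter_filter_lt hq fun _ => True
  simpa using this

theorem prefixSum_mul {n c : ℕ} (x : Fin (n * c) → ℕ) (q : ℕ) :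
    prefixSum x (q * c) = ∑ j : Fin n with j.val < q, ∑ i, x (finProdFinEquiv (j, i)) := by
  rw [prefixSum, Finset.sum_filter, Finset.sum_filter, ← finProdFinEquiv.sum_comp,
    Fintype.sum_prod_type]
  refine Finset.sum_congr rfl fun j _ => ?_
  have hlt (i : Fin c) : (finProdFinEquiv (j, i)).val < q * c ↔ j.val < q := by
    rw [finProdFinEquiv_apply_val]
    simp only
    constructor
    · intro h
      by_contra hge
      have := Nat.mul_le_mul_right c (not_lt.1 hge)
      rw [mul_comm c] at h
      omega
    · intro h
      have := Nat.mul_le_mul_right c (show j.val + 1 ≤ q from h)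
      rw [Nat.add_mul, Nat.one_mul] at this
      rw [mul_comm c]
      omega
  simp_rw [hlt]
  split_ifs <;> simp

/-- The vectors of length `n c` with entries in `{0, …, t}`, cut into `n` blocks. -/
def blockEquiv (n c t : ℕ) : (Fin (n * c) → Fin (t + 1)) ≃ (Fin n → Fin c → Fin (t + 1)) :=
  (finProdFinEquiv.symm.arrowCongr (Equiv.refl _)).trans (Equiv.curry _ _ _)

theorem blockEquiv_apply {n c t : ℕ} (x : Fin (n * c) → Fin (t + 1)) (j : Fin n) (i : Fin c) :
    blockEquiv n c t x j i = x (finProdFinEquiv (j, i)) := rfl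

theorem walkSum_blocks {n c t d q : ℕ} (hq : q ≤ n) (x : Fin (n * c) → Fin (t + 1)) :
    walkSum (blockHeight c t d) ((List.ofFn (blockEquiv n c t x)).take q) =
      (prefixSum (fun i => (x i : ℕ)) (q * c) : ℤ) - (q * d : ℕ) := by
  rw [walkSum_take_ofFn, prefixSum_mul]
  simp only [blockHeight, blockEquiv_apply]
  rw [Finset.sum_sub_distrib, Finset.sum_const, card_filter_val_lt hq]
  simp

theorem walkSum_blocks_total {n c t d : ℕ} (x : Fin (n * c) → Fin (t + 1)) :
    walkSum (blockHeight c t d) (List.ofFn (blockEquiv n c t x)) =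
      ((∑ i, (x i : ℕ) : ℕ) : ℤ) - (n * d : ℕ) := by
  have h := walkSum_blocks (d := d) le_rfl x
  rwa [List.take_of_length_le (by simp), prefixSum_self] at h

theorem isExcursion_iff_take {α : Type*} {h : α → ℤ} {l : List α} {n : ℕ} (hl : l.length = n) :
    IsExcursion h l ↔ walkSum h l = 0 ∧ ∀ q ≤ n, 0 ≤ walkSum h (l.take q) := by
  refine and_congr_right fun _ => ⟨fun H q _ => H _ _ (List.take_append_drop q l).symm,
    fun H u v huv => ?_⟩
  subst huv
  have := H u.length (by rw [← hl, List.length_append]; omega)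
  rwa [List.take_left] at this

theorem card_lists_eq {α : Type*} (n : ℕ) (P : List α → Prop) :
    Nat.card {l : List α // l.length = n ∧ P l} =
      Nat.card {y : Fin n → α // P (List.ofFn y)} := by
  refine (Nat.card_congr (Equiv.ofBijective
    (fun y => ⟨List.ofFn y.1, List.length_ofFn, y.2⟩) ⟨?_, ?_⟩)).symm
  · rintro ⟨y, hy⟩ ⟨z, hz⟩ h
    simp only [Subtype.mk.injEq] at h ⊢
    exact List.ofFn_injective h
  · rintro ⟨l, rfl, hl⟩
    exact ⟨⟨l.get, by rwa [List.ofFn_get]⟩, by simp⟩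

theorem card_walks_eq {n c t : ℕ} (P : List (Fin c → Fin (t + 1)) → Prop) :
    Nat.card {l : List (Fin c → Fin (t + 1)) // l.length = n ∧ P l} =
      Nat.card {x : Fin (n * c) → Fin (t + 1) // P (List.ofFn (blockEquiv n c t x))} := by
  rw [card_lists_eq]
  exact (Nat.card_congr ((blockEquiv n c t).subtypeEquiv fun _ => Iff.rfl)).symm

/-- After `q` blocks the height is the prefix sum minus `q * (t * b)`, so the bounds at block ends
are nonnegativity of the walk. -/
theorem latticeCount_catalanMatroid_eq_excursions {a b n t : ℕ} (hab : 0 < a + b) (ht : 0 < t) :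
    latticeCount (matroidPolytope (catalanMatroid a b n)) t =
      Nat.card (Excursions (blockHeight (a + b) t (t * b)) n) := by
  rw [latticeCount_catalanMatroid hab ht, card_walks_eq]
  refine Nat.card_congr (Equiv.subtypeEquivRight fun x => ?_)
  rw [isExcursion_iff_take List.length_ofFn, walkSum_blocks_total]
  refine and_congr ?_ (forall₂_congr fun q hq => ?_)
  · rw [sub_eq_zero, Nat.cast_inj]
  · rw [walkSum_blocks hq, sub_nonneg, Nat.cast_le]

theorem latticeCount_uniformAB_eq_bridges {a b m t : ℕ} (ht : 0 < t) :
    latticeCount (matroidPolytope (uniformAB a b m)) t =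
      Nat.card (Bridges (blockHeight (a + b) t (t * b)) m) := by
  rw [uniformAB, latticeCount_uniformMatroid (Nat.mul_le_mul_left m (Nat.le_add_left b a)) ht,
    card_walks_eq]
  refine Nat.card_congr (Equiv.subtypeEquivRight fun x => ?_)
  rw [walkSum_blocks_total, sub_eq_zero, Nat.cast_inj, mul_left_comm]

/-! Ehrhart polynomials -/

theorem IsEhrhartPolynomial.unique {α : Type*} {P : Set (α → ℝ)} {p q : Polynomial ℚ}
    (hp : IsEhrhartPolynomial P p) (hq : IsEhrhartPolynomial P q) : p = q := by
  refine Polynomial.eq_of_infinite_eval_eq p q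
    ((Set.infinite_range_of_injective (f := fun n : ℕ => ((n + 1 : ℕ) : ℚ)) fun m n h => by
      simpa using h).mono ?_)
  rintro _ ⟨n, rfl⟩
  exact (hp _ n.succ_pos).trans (hq _ n.succ_pos).symm

theorem IsEhrhartPolynomial.ehrhart_eq {α : Type*} {M : Matroid α} {p : Polynomial ℚ}
    (hp : IsEhrhartPolynomial (matroidPolytope M) p) : ehrhart M = p := by
  have h : ∃ p, IsEhrhartPolynomial (matroidPolytope M) p := ⟨p, hp⟩
  rw [ehrhart, dif_pos h]
  exact h.choose_spec.unique hp

/-! ### Closure properties of coefficient positivity -/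

/-- The polynomial is nonzero and all its coefficients up to the degree are positive. -/
def CoeffsPos (p : Polynomial ℚ) : Prop :=
  ∃ d, (∀ j ≤ d, 0 < p.coeff j) ∧ ∀ j, d < j → p.coeff j = 0

theorem CoeffsPos.nonneg {p : Polynomial ℚ} (hp : CoeffsPos p) (j : ℕ) : 0 ≤ p.coeff j := by
  obtain ⟨d, h1, h2⟩ := hp
  rcases Nat.lt_or_ge d j with h | h
  · exact (h2 j h).ge
  · exact (h1 j h).le

theorem CoeffsPos.pos {p : Polynomial ℚ} (hp : CoeffsPos p) : ∀ j ≤ p.natDegree, 0 < p.coeff j := by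
  obtain ⟨d, h1, h2⟩ := hp
  intro j hj
  refine h1 j (hj.trans (Polynomial.natDegree_le_iff_coeff_eq_zero.2 h2))

theorem CoeffsPos.one : CoeffsPos 1 := by
  refine ⟨0, fun j hj => ?_, fun j hj => ?_⟩
  · rw [Nat.le_zero.1 hj]; simp
  · rw [Polynomial.coeff_one, if_neg hj.ne']

theorem CoeffsPos.mul {p q : Polynomial ℚ} (hp : CoeffsPos p) (hq : CoeffsPos q) :
    CoeffsPos (p * q) := by
  have hnn := fun x : ℕ × ℕ => mul_nonneg (hp.nonneg x.1) (hq.nonneg x.2)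
  obtain ⟨d, hp1, hp2⟩ := hp
  obtain ⟨e, hq1, hq2⟩ := hq
  refine ⟨d + e, fun j hj => ?_, fun j hj => ?_⟩
  · rw [Polynomial.coeff_mul]
    -- Filling the first index up to `d` before using the second keeps both in their positive
    -- ranges.
    refine Finset.sum_pos' (fun x _ => hnn x) ⟨(min j d, j - min j d), ?_, ?_⟩
    · rw [Finset.HasAntidiagonal.mem_antidiagonal]
      simp only
      omega
    · exact mul_pos (hp1 _ (by simp)) (hq1 _ (by simp only; omega))
  · rw [Polynomial.coeff_mul]
    refine Finset.sum_eq_zero fun x hx => ?_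
    rw [Finset.HasAntidiagonal.mem_antidiagonal] at hx
    rcases Nat.lt_or_ge d x.1 with h | h
    · rw [hp2 _ h, zero_mul]
    · rw [hq2 x.2 (by omega), mul_zero]

/-- The degrees may differ, as they do for partitions with different numbers of parts; beyond the
smaller degree the other summand alone is positive. -/
theorem CoeffsPos.add {p q : Polynomial ℚ} (hp : CoeffsPos p) (hq : CoeffsPos q) :
    CoeffsPos (p + q) := by
  have hpn := hp.nonneg
  have hqn := hq.nonneg
  obtain ⟨d, hp1, hp2⟩ := hp
  obtain ⟨e, hq1, hq2⟩ := hq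
  refine ⟨max d e, fun j hj => ?_, fun j hj => ?_⟩
  · rw [Polynomial.coeff_add]
    rcases le_max_iff.1 hj with h | h
    · exact add_pos_of_pos_of_nonneg (hp1 j h) (hqn j)
    · exact add_pos_of_nonneg_of_pos (hpn j) (hq1 j h)
  · rw [max_lt_iff] at hj
    rw [Polynomial.coeff_add, hp2 j hj.1, hq2 j hj.2, add_zero]

theorem CoeffsPos.smul {p : Polynomial ℚ} (hp : CoeffsPos p) {c : ℚ} (hc : 0 < c) :
    CoeffsPos (c • p) := by
  obtain ⟨d, h1, h2⟩ := hp
  refine ⟨d, fun j hj => ?_, fun j hj => ?_⟩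
  · rw [Polynomial.coeff_smul]
    exact mul_pos hc (h1 j hj)
  · rw [Polynomial.coeff_smul, h2 j hj, smul_zero]

theorem coeffsPos_hypersimplexPoly {k N : ℕ} (hk0 : 0 < k) (hk : k < N) :
    CoeffsPos (hypersimplexPoly k N) :=
  ⟨N - 1, fun _ hj => coeff_hypersimplexPoly_pos hk0 hk hj,
    fun _ hj => coeff_hypersimplexPoly_eq_zero hj⟩

/-! ### Ehrhart polynomials of the uniform, direct sum and Catalan matroids -/

theorem isEhrhartPolynomial_uniformAB {a b m : ℕ} (ha : 0 < a) (hm : 0 < m) :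
    IsEhrhartPolynomial (matroidPolytope (uniformAB a b m))
      (hypersimplexPoly (m * b) (m * (a + b))) :=
  isEhrhartPolynomial_uniformMatroid (Nat.mul_lt_mul_of_pos_left (by omega) hm)

theorem isEhrhartPolynomial_uniformSumAB {a b n : ℕ} (ha : 0 < a) (lam : n.Partition) :
    IsEhrhartPolynomial (matroidPolytope (uniformSumAB a b lam))
      (lam.parts.map fun m => hypersimplexPoly (m * b) (m * (a + b))).prod := by
  intro t ht
  have h : latticeCount (matroidPolytope (uniformSumAB a b lam)) t =
      ∏ m : lam.parts, latticeCount (matroidPolytope (uniformAB a b (m : ℕ))) t :=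
    latticeCount_sigma (M := fun m : lam.parts => uniformAB a b (m : ℕ)) ht fun m x hx =>
      isBaseSum_of_mem_smul_uniformMatroid (Nat.mul_le_mul_left _ (Nat.le_add_left b a)) ht x hx
  have hprod : ∏ m : lam.parts, hypersimplexPoly ((m : ℕ) * b) ((m : ℕ) * (a + b)) =
      (lam.parts.map fun m => hypersimplexPoly (m * b) (m * (a + b))).prod :=
    congrArg Multiset.prod (Multiset.map_univ lam.parts
      fun m => hypersimplexPoly (m * b) (m * (a + b)))
  rw [h, Nat.cast_prod, ← hprod, Polynomial.eval_prod]
  refine Finset.prod_congr rfl fun m _ => ?_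
  exact isEhrhartPolynomial_uniformAB ha (lam.parts_pos Multiset.coe_mem) t ht

/-- For fixed `t` the step alphabet does not depend on `n`, so the recursion applies to all lengths
at once and determines the count of excursions from the counts of bridges. -/
theorem isEhrhartPolynomial_catalanMatroid {a b : ℕ} (ha : 0 < a) (n : ℕ) :
    IsEhrhartPolynomial (matroidPolytope (catalanMatroid a b n))
      (∑ lam : n.Partition, (1 / (zPartition lam : ℚ)) •
        (lam.parts.map fun m => hypersimplexPoly (m * b) (m * (a + b))).prod) := by
  intro t ht
  have hcat := eq_partitionSum
    (c := fun n => (Nat.card (Excursions (blockHeight (a + b) t (t * b)) n) : ℚ))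
    (p := fun n => (Nat.card (Bridges (blockHeight (a + b) t (t * b)) n) : ℚ))
    (by simp only [card_excursions_zero, Nat.cast_one])
    (fun n => by exact_mod_cast card_excursions_recursion (blockHeight (a + b) t (t * b)) n) n
  rw [latticeCount_catalanMatroid_eq_excursions (by omega) ht, hcat, partitionSum,
    Polynomial.eval_finsetSum]
  refine Finset.sum_congr rfl fun lam _ => ?_
  rw [Polynomial.eval_smul, smul_eq_mul, Polynomial.eval_multiset_prod, Multiset.map_map]
  congr 2
  refine Multiset.map_congr rfl fun m hm => ?_
  rw [Function.comp_apply, isEhrhartPolynomial_uniformAB ha (lam.parts_pos hm) t ht,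
    latticeCount_uniformAB_eq_bridges ht]

theorem coeffsPos_prod_parts {a b n : ℕ} (ha : 0 < a) (hb : 0 < b) (lam : n.Partition) :
    CoeffsPos (lam.parts.map fun m => hypersimplexPoly (m * b) (m * (a + b))).prod := by
  refine Multiset.prod_induction CoeffsPos _ (fun _ _ => CoeffsPos.mul) CoeffsPos.one ?_
  intro p hp
  obtain ⟨m, hm, rfl⟩ := Multiset.mem_map.1 hp
  have := lam.parts_pos hm
  exact coeffsPos_hypersimplexPoly (Nat.mul_pos this hb)
    (Nat.mul_lt_mul_of_pos_left (by omega) this)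

theorem corollary4p1 (a b n : ℕ) (ha : 0 < a) (hb : 0 < b) (hn : 0 < n) :
    -- the polytopes involved have Ehrhart polynomials
    IsEhrhartPolynomial (matroidPolytope (catalanMatroid a b n)) (ehrhart (catalanMatroid a b n)) ∧
    (∀ m : ℕ, 0 < m →
      IsEhrhartPolynomial (matroidPolytope (uniformAB a b m)) (ehrhart (uniformAB a b m))) ∧
    (∀ lam : n.Partition,
      IsEhrhartPolynomial (matroidPolytope (uniformSumAB a b lam))
        (ehrhart (uniformSumAB a b lam))) ∧
    -- the Ehrhart polynomial of a direct sum is the product over the summands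
    (∀ lam : n.Partition,
      ehrhart (uniformSumAB a b lam) =
        (lam.parts.map fun m => ehrhart (uniformAB a b m)).prod) ∧
    -- the formula
    ehrhart (catalanMatroid a b n) =
      ∑ lam : n.Partition, (1 / (zPartition lam : ℚ)) • ehrhart (uniformSumAB a b lam) ∧
    -- Ehrhart positivity
    EhrhartPositive (catalanMatroid a b n) := by
  have hC := isEhrhartPolynomial_catalanMatroid (b := b) ha n
  have hS (lam : n.Partition) := isEhrhartPolynomial_uniformSumAB (b := b) ha lam
  have hU (m : ℕ) (hm : 0 < m) := isEhrhartPolynomial_uniformAB (b := b) ha hm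
  refine ⟨?_, fun m hm => ?_, fun lam => ?_, fun lam => ?_, ?_, ?_, ?_⟩
  · rwa [hC.ehrhart_eq]
  · rw [(hU m hm).ehrhart_eq]
    exact hU m hm
  · rw [(hS lam).ehrhart_eq]
    exact hS lam
  · rw [(hS lam).ehrhart_eq]
    congr 1
    exact Multiset.map_congr rfl fun m hm => (hU m (lam.parts_pos hm)).ehrhart_eq.symm
  · rw [hC.ehrhart_eq]
    exact Finset.sum_congr rfl fun lam _ => by rw [(hS lam).ehrhart_eq]
  · rwa [hC.ehrhart_eq]
  · rw [hC.ehrhart_eq]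
    -- The zero polynomial is not `CoeffsPos`, so the sum must be known to be nonempty.
    have : Nonempty n.Partition := ⟨Nat.Partition.indiscrete n⟩
    refine CoeffsPos.pos (Finset.sum_induction_nonempty _ CoeffsPos (fun _ _ => CoeffsPos.add)
      Finset.univ_nonempty fun lam _ => (coeffsPos_prod_parts ha hb lam).smul ?_)
    have := Nat.pos_of_ne_zero (zPartition_ne_zero lam)
    positivity
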